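/- For a prime $p$ and integers $e\ge 1$, $r\ge 2$, let $W(2r-1,p^e)$ be the symplectic polar space of a non-degenerate alternating form on a $2r$-dimensional vector space $V$ over $\mathbb F_{p^e}$. Its points are the points of $\mathrm{PG}(V)$, and its maximals are the totally isotropic subspaces of maximum dimension. An $m$-ovoid is a set of points meeting every maximal in exactly $m$ points. Let $(p,r)\in\{(3,5),(5,7),(5,11)\}$. For an integer $\ell_0\ge 1$ put $e=2\ell_0$ and $$d_0=d_0(\ell_0)=\gcd\Bigl(\frac{p^{r\ell_0}+1}{2},\ \frac{p^{2r\ell_0}-1}{p^{2\ell_0}-1}\Bigr).$$ 1. For every $\ell_0\ge 1$, the number $\frac{p^{r\ell_0}+1}{p^{\ell_0}+1}$ is an integer that divides $d_0$, and $d_0>1$. 2. For all integers $\ell_0\ge1$ and $1\le b\le d_0-1$, the number $m=m(\ell_0,b)=\frac{b(p^{er}-1)}{d_0(p^e-1)}$ is a positive integer, $W(2r-1,p^e)$ has an $m$-ovoid, and $$\frac{m}{p^{e(r-2)}}\le \frac{b\,(p^{r\ell_0}-1)}{(p^{\ell_0}-1)\,p^{e(r-2)}}.$$ 3. For every fixed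 integer $b\ge 1$, the condition $b\le d_0-1$ holds for all sufficiently large $\ell_0$, and $\lim_{\ell_0\to\infty} \frac{m(\ell_0,b)}{p^{e(r-2)}}=0$. 4. Consequently, for each of these three pairs $(p,r)$ there is no constant $c>0$ such that $m\ge c\,p^{e(r-2)}$ whenever $e\ge1$, $m\ge 1$ and $W(2r-1,p^e)$ has an $m$-ovoid. In particular, the conjecture of Bamberg et al. is false: there is no constant $c>0$ such that, for all primes $p$ and all integers $e\ge 1$, $r>2$, $m\ge1$, the existence of an $m$-ovoid in $W(2r-1,p^e)$ implies $m\ge c\,p^{e(r-2)}$. -/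

import Mathlib

open scoped LinearAlgebra.Projectivization
open Filter Topology

universe u v

/-- `B` is a non-degenerate alternating form on a `2r`-dimensional vector space `V` over a field `F`
with `p ^ e` elements; the symplectic polar space `W(2r-1, p^e)` is the geometry of its totally
isotropic subspaces. -/
structure IsSymplecticForm (p e r : ℕ) {F : Type u} {V : Type v} [Field F] [AddCommGroup V]
    [Module F V] (B : LinearMap.BilinForm F V) : Prop where
  card_eq : Nat.card F = p ^ e
  finrank_eq : Module.finrank F V = 2 * r
  isAlt : B.IsAlt
  nondegenerate : B.Nondegenerate

/-- `U` is totally isotropic: the form vanishes identically on `U`. -/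
def IsTotallyIsotropic {F : Type u} {V : Type v} [Field F] [AddCommGroup V] [Module F V]
    (B : LinearMap.BilinForm F V) (U : Submodule F V) : Prop :=
  ∀ x ∈ U, ∀ y ∈ U, B x y = 0

/-- `U` is a maximal (generator): a totally isotropic subspace of maximum dimension. -/
def IsGenerator {F : Type u} {V : Type v} [Field F] [AddCommGroup V] [Module F V]
    (B : LinearMap.BilinForm F V) (U : Submodule F V) : Prop :=
  IsTotallyIsotropic B U ∧
    ∀ U' : Submodule F V, IsTotallyIsotropic B U' → Module.finrank F U' ≤ Module.finrank F U

/-- An `m`-ovoid of the polar space of `B`: a set of points of `PG(V)` (all of which are isotropic,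
as `B` is alternating) that meets every maximal in exactly `m` points. -/
def IsMOvoid {F : Type u} {V : Type v} [Field F] [AddCommGroup V] [Module F V]
    (B : LinearMap.BilinForm F V) (m : ℕ) (M : Set (ℙ F V)) : Prop :=
  ∀ U : Submodule F V, IsGenerator B U → {P ∈ M | P.submodule ≤ U}.encard = m

/-- `d₀ = gcd (N / 2, (√q - 1) / (p ^ e - 1))` with `N = p ^ ℓ + 1` and `√q = p ^ (e * r)`. -/
def dZero (p e r ℓ : ℕ) : ℕ :=
  Nat.gcd ((p ^ ℓ + 1) / 2) ((p ^ (e * r) - 1) / (p ^ e - 1))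

/-- `m = b (√q - 1) / (d₀ (p ^ e - 1))` with `√q = p ^ (e * r)`. -/
def ovoidParam (p e r ℓ b : ℕ) : ℕ :=
  b * (p ^ (e * r) - 1) / (dZero p e r ℓ * (p ^ e - 1))

/-- For the given `p`, `r`, `c`: whenever `W(2r-1, p^e)`, `e ≥ 1`, has an `m`-ovoid with `m ≥ 1`
(the empty set is a `0`-ovoid), then `m ≥ c * p ^ (e * (r - 2))`. -/
def OvoidLowerBound (p r : ℕ) (c : ℝ) : Prop :=
  ∀ (e m : ℕ), 1 ≤ e → 1 ≤ m →
    ∀ (F V : Type) [Field F] [AddCommGroup V] [Module F V] (B : LinearMap.BilinForm F V),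
      IsSymplecticForm p e r B → (∃ M : Set (ℙ F V), IsMOvoid B m M) →
        c * (p : ℝ) ^ (e * (r - 2)) ≤ m

/-- The conjecture of Bamberg et al.: with one constant `c > 0`, every `m`-ovoid (`m ≥ 1`) in
`W(2r-1, p^e)` with `r > 2` has `m ≥ c * p ^ (e * (r - 2))`. -/
def BambergConjecture : Prop :=
  ∃ c : ℝ, 0 < c ∧ ∀ p r : ℕ, p.Prime → 2 < r → OvoidLowerBound p r c

/-! ### Power maps on finite cyclic groups. -/

section Cyclic

variable {G : Type*} [CommGroup G] [IsCyclic G]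

/-! Put `P = p ^ (r * ℓ₀)`, so that a maximal has `P ^ 2` vectors. The space is modelled on the
field `L` of order `P ^ 4` with the form `Tr (λ x y ^ (P ^ 2))`, where `λ ^ (P ^ 2) = -λ`; this
loses nothing, by `exists_symplectic_isometry`. Let `d = d₀`, which is odd, and `n = (P ^ 4 - 1) /
d`. The ovoid comes from a union `D` of `b` cyclotomic classes of order `d`: the `x` in `Lˣ` with `x
^ n` in an inverse-closed set `J` of `b` of the `d`-th roots of unity.

As `d` divides `P + 1`, the classes are semiprimitive. The sums of `ψ (a x ^ (P + 1))` take only the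
values `-P ^ 3` and `P ^ 2` for `a ≠ 0` (`powSum_pow`, `powSum_of_not_pow`), so the sum of `ψ (a x)`
over `D` depends only on whether `a ^ n ∈ J`. For self-orthogonal `U`, sum `ψ (λ u ^ (P ^ 2) x)`
over `u ∈ U` and `x ∈ D` in two ways: orthogonality gives `P ^ 2 |D ∩ U|`, the two-valued sums give
a constant minus `P ^ 2 |D ∩ U|`. Hence `|D ∩ U|` is the same for all `U` (`card_filter_mem`). The
second entry of the gcd makes `D` invariant under scalars, hence a set of points.

Finally `(P + 1) / (p ^ ℓ₀ + 1)` divides `d₀`, so for fixed `b` the parameter `m` is `O(p ^ ((r - 1)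
ℓ₀))`, which is `o(p ^ (2 ℓ₀ (r - 2)))`. The three pairs enter only through `p` being an odd prime
and `r ≥ 5` being odd. -/

theorem exists_pow_eq_of_pow_eq_one [Finite G] {n m : ℕ} (h : n * m = Nat.card G) {x : G}
    (hx : x ^ m = 1) : ∃ y : G, y ^ n = x := by
  obtain ⟨g, hg⟩ := IsCyclic.exists_generator (α := G)
  obtain ⟨k, rfl⟩ := hg x
  have hm : (m : ℤ) ≠ 0 := by
    rintro hm
    have : Nat.card G ≠ 0 := Nat.card_pos.ne'
    simp_all
  have hk : g ^ (k * m) = 1 := by rw [zpow_mul, zpow_natCast]; exact hx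
  rw [← orderOf_dvd_iff_zpow_eq_one, orderOf_eq_card_of_forall_mem_zpowers hg, ← h] at hk
  push_cast at hk
  obtain ⟨j, rfl⟩ := (mul_dvd_mul_iff_right hm).1 hk
  refine ⟨g ^ j, ?_⟩
  change _ = g ^ ((n : ℤ) * j)
  rw [mul_comm, zpow_mul, zpow_natCast]

theorem card_pow_eq_one_of_dvd_card [Fintype G] [DecidableEq G] {n : ℕ} (h : n ∣ Nat.card G) :
    (Finset.univ.filter fun x : G => x ^ n = 1).card = n := by
  have h1 := (powMonoidHom n : G →* G).ker.card_mul_index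
  rw [Subgroup.index_ker, IsCyclic.card_powMonoidHom_range, Nat.gcd_eq_right h] at h1
  have h0 : 0 < Nat.card G := Nat.card_pos
  have h2 : Nat.card (powMonoidHom n : G →* G).ker = n := by
    obtain ⟨m, hm⟩ := h
    have hn : 0 < n := Nat.pos_of_ne_zero (by rintro rfl; simp at hm)
    have hm0 : 0 < m := Nat.pos_of_ne_zero (by rintro rfl; simp at hm)
    rw [hm, Nat.mul_div_cancel_left _ hn] at h1
    exact Nat.eq_of_mul_eq_mul_right hm0 h1
  refine Eq.trans ?_ h2
  rw [Nat.card_eq_fintype_card]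
  refine (Fintype.card_of_subtype _ fun x => ?_).symm
  simp [MonoidHom.mem_ker]

theorem card_pow_eq_pow [Fintype G] [DecidableEq G] {n : ℕ} (h : n ∣ Nat.card G) (y : G) :
    (Finset.univ.filter fun x : G => x ^ n = y ^ n).card = n := by
  refine Eq.trans ?_ (card_pow_eq_one_of_dvd_card h)
  exact MonoidHom.card_fiber_eq_of_mem_range (powMonoidHom n : G →* G) (x := y ^ n) (y := 1)
    ⟨y, rfl⟩ ⟨1, one_pow n⟩

end Cyclic

/-- A rational number that is an algebraic integer in `ℂ` is an integer. -/
theorem exists_int_of_isIntegral_ratCast {r : ℚ} (h : IsIntegral ℤ (r : ℂ)) : ∃ k : ℤ, (k : ℚ) = r := by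
  have h' : IsIntegral ℤ r := by
    have := (isIntegral_algebraMap_iff (R := ℤ) (algebraMap ℚ ℂ).injective (x := r))
    simpa using this.1 (by simpa using h)
  exact IsIntegrallyClosed.isIntegral_iff.1 h'

/-! ### Semiprimitive exponential sums over a field of order `P ^ 4`. -/

section CharacterSum

variable {L : Type*} [Field L] [Fintype L]

/-- The exponential sum of the form `x ↦ a * x ^ (P + 1)`. -/
noncomputable def powSum (ψ : AddChar L ℂ) (P : ℕ) (a : L) : ℂ := ∑ x : L, ψ (a * x ^ (P + 1))

/-- A primitive additive character of a field of order `P ^ 4`, `P` odd, where `x ↦ x ^ P` is a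
field automorphism fixing the character. -/
structure FrobeniusChar (ψ : AddChar L ℂ) (P : ℕ) : Prop where
  primitive : ψ.IsPrimitive
  card_eq : Fintype.card L = P ^ 4
  odd : Odd P
  one_lt : 1 < P
  add_pow (x y : L) : (x + y) ^ P = x ^ P + y ^ P
  map_pow (x : L) : ψ (x ^ P) = ψ x

theorem pow_four_sub_one (P : ℕ) (hP : 1 ≤ P) : P ^ 4 - 1 = (P + 1) * ((P - 1) * (P ^ 2 + 1)) := by
  obtain ⟨k, rfl⟩ := Nat.exists_eq_add_of_le hP
  simp only [Nat.add_sub_cancel_left]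
  apply Nat.sub_eq_of_eq_add
  ring

namespace FrobeniusChar

variable {ψ : AddChar L ℂ} {P : ℕ}

theorem card_units (h : FrobeniusChar ψ P) :
    Nat.card Lˣ = (P + 1) * ((P - 1) * (P ^ 2 + 1)) := by
  rw [Nat.card_units, Nat.card_eq_fintype_card, h.card_eq, pow_four_sub_one _ h.one_lt.le]

theorem sub_one_mul (h : FrobeniusChar ψ P) : (P - 1) * (P + 1) = P ^ 2 - 1 := by
  have := h.one_lt
  have := Nat.sq_sub_sq P 1
  rw [mul_comm]; simpa using this.symm

theorem bijective_pow (h : FrobeniusChar ψ P) : Function.Bijective fun x : L => x ^ P := by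
  refine Finite.injective_iff_bijective.1 fun x y hxy => ?_
  have h1 : ∀ z : L, (z ^ P) ^ (P ^ 3) = z := fun z => by
    rw [← pow_mul, show P * P ^ 3 = Fintype.card L by rw [h.card_eq]; ring, FiniteField.pow_card]
  rw [← h1 x, ← h1 y]
  exact congrArg (· ^ (P ^ 3)) hxy

/-- The value is its own inverse, hence `1` or `-1`, and also a root of unity of the odd order `P ^
4`. -/
theorem eq_one_of_map_neg (h : FrobeniusChar ψ P) {t : L} (ht : ψ t = ψ (-t)) : ψ t = 1 := by
  have h1 : ψ t ^ 2 = 1 := by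
    rw [sq]; nth_rewrite 2 [ht]
    rw [← AddChar.map_add_eq_mul]; simp
  have h2 : ψ t ^ (P ^ 4) = 1 := by
    rw [← AddChar.map_nsmul_eq_pow, ← h.card_eq, ← Nat.card_eq_fintype_card, card_nsmul_eq_zero', AddChar.map_zero_eq_one] 
  obtain ⟨k, hk⟩ := h.odd.pow (n := 4)
  rw [hk, pow_succ, pow_mul, h1] at h2
  simpa using h2

theorem exists_pow_eq_neg_one (h : FrobeniusChar ψ P) : ∃ c : Lˣ, c ^ ((P - 1) * (P + 1)) = -1 := by
  obtain ⟨k, hk⟩ := h.odd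
  refine exists_pow_eq_of_pow_eq_one (m := P ^ 2 + 1) (by rw [h.card_units]; ring) ?_
  refine Even.neg_one_pow ⟨2 * k ^ 2 + 2 * k + 1, ?_⟩
  rw [hk]; ring

/-- Since `-1` is a `(P + 1)`-th power, a substitution in `x` absorbs it. -/
theorem powSum_neg (h : FrobeniusChar ψ P) (a : L) : powSum ψ P (-a) = powSum ψ P a := by
  obtain ⟨c, hc⟩ := h.exists_pow_eq_neg_one
  have hc' : ((c : L) ^ (P - 1)) ^ (P + 1) = -1 := by
    rw [← pow_mul]; simpa using congrArg Units.val hc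
  unfold powSum
  refine Fintype.sum_equiv (Equiv.mulLeft₀ ((c : L) ^ (P - 1)) (pow_ne_zero _ c.ne_zero)) _ _ fun x => ?_
  rw [Equiv.mulLeft₀_apply]
  rw [mul_pow, hc']; congr 1; ring

theorem powSum_mul_pow (a : L) (g : Lˣ) : powSum ψ P (a * g ^ (P + 1)) = powSum ψ P a := by
  unfold powSum
  refine Fintype.sum_equiv (Equiv.mulLeft₀ (g : L) g.ne_zero) _ _ fun x => ?_
  rw [Equiv.mulLeft₀_apply]
  rw [mul_pow]; congr 1; ring

/-- This fixes the sign of `powSum`: by `isIntegral_powSum` the sum is `1` modulo `P + 1`, the wrong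
sign would make it `-1`, and `P + 1 > 2` does not divide `2`. -/
theorem not_isIntegral_two_div (h : FrobeniusChar ψ P) {x : ℂ} {k : ℤ} (hx : IsIntegral ℤ (x / (P + 1)))
    (hk : x = k * (P + 1) - 2) : False := by
  have hP : (P + 1 : ℂ) ≠ 0 := by exact_mod_cast P.succ_ne_zero
  have h1 : IsIntegral ℤ (((2 : ℚ) / (P + 1) : ℚ) : ℂ) := by
    have : (((2 : ℚ) / (P + 1) : ℚ) : ℂ) = (k : ℂ) - x / (P + 1) := by
      rw [hk]; push_cast; field_simp; ring
    rw [this]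
    exact (isIntegral_algebraMap (R := ℤ) (A := ℂ) (x := k)).sub hx
  obtain ⟨j, hj⟩ := exists_int_of_isIntegral_ratCast h1
  have hP1 := h.one_lt
  have hP' : (P + 1 : ℚ) ≠ 0 := by exact_mod_cast P.succ_ne_zero
  rw [eq_div_iff hP'] at hj
  have hj' : j * (P + 1) = 2 := by exact_mod_cast hj
  have : j > 0 := by by_contra hc; nlinarith
  nlinarith [h.odd, hP1]

variable [DecidableEq L]

theorem powSum_eq_one_add (a : L) : powSum ψ P a = 1 + ∑ x : Lˣ, ψ (a * x ^ (P + 1)) := by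
  rw [powSum, Fintype.sum_eq_add_sum_compl (0 : L)]
  congr 1
  · simp
  · refine (Finset.sum_bij (fun (x : Lˣ) _ => (x : L)) ?_ ?_ ?_ ?_).symm
    · simp
    · intro x _ y _ hxy; exact Units.ext hxy
    · intro b hb
      exact ⟨Units.mk0 b (by simpa using hb), by simp, rfl⟩
    · intro x _; simp

/-- Write the square as `powSum ψ P a * powSum ψ P (-a)` and substitute `x = z + y`. Applying
Frobenius to the cross term `a z y ^ P` makes the exponent additive in `z ^ P`, so the sum over `z`
vanishes off the kernel of `y ↦ a y + a ^ P y ^ (P ^ 2)`. On the kernel Frobenius negates `a y ^ (P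
+ 1)`, so the remaining factor is `1`. -/
theorem powSum_sq (h : FrobeniusChar ψ P) (a : L) :
    powSum ψ P a ^ 2 = P ^ 4 *
      ((Finset.univ.filter fun y : L => a * y + a ^ P * y ^ (P ^ 2) = 0).card : ℂ) := by
  have key : ∀ y z : L, ψ (a * (z + y) ^ (P + 1)) * ψ (-a * z ^ (P + 1)) =
      ψ (a * y ^ (P + 1)) * ψ (z ^ P * (a * y + a ^ P * y ^ (P ^ 2))) := fun y z => by
    have e1 : ψ (a * (z * y ^ P)) = ψ (a ^ P * (z ^ P * y ^ (P ^ 2))) := by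
      rw [← h.map_pow, mul_pow, mul_pow, ← pow_mul, ← sq]
    rw [← AddChar.map_add_eq_mul, pow_succ, h.add_pow,
      show a * ((z ^ P + y ^ P) * (z + y)) + -a * z ^ (P + 1) =
        a * y ^ (P + 1) + (z ^ P * (a * y) + a * (z * y ^ P)) by ring,
      AddChar.map_add_eq_mul, AddChar.map_add_eq_mul, e1, ← AddChar.map_add_eq_mul]
    congr 2; ring
  have hR : ∀ y : L, a * y + a ^ P * y ^ (P ^ 2) = 0 → ψ (a * y ^ (P + 1)) = 1 := fun y hy => by
    refine h.eq_one_of_map_neg ?_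
    rw [← h.map_pow]
    congr 1
    have : a ^ P * y ^ (P ^ 2) = -(a * y) := by linear_combination hy
    calc (a * y ^ (P + 1)) ^ P = a ^ P * y ^ (P ^ 2) * y ^ P := by ring
      _ = _ := by rw [this]; ring
  calc powSum ψ P a ^ 2 = powSum ψ P a * powSum ψ P (-a) := by rw [h.powSum_neg, sq]
    _ = ∑ z : L, ∑ x : L, ψ (a * x ^ (P + 1)) * ψ (-a * z ^ (P + 1)) := by
      rw [powSum, powSum, Finset.sum_mul_sum, Finset.sum_comm]
    _ = ∑ z : L, ∑ y : L, ψ (a * (z + y) ^ (P + 1)) * ψ (-a * z ^ (P + 1)) := by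
      refine Finset.sum_congr rfl fun z _ => ?_
      exact (Fintype.sum_equiv (Equiv.addLeft z) _ _ fun y => rfl).symm
    _ = ∑ y : L, ψ (a * y ^ (P + 1)) *
          ∑ z : L, ψ (z ^ P * (a * y + a ^ P * y ^ (P ^ 2))) := by
      simp_rw [key, Finset.mul_sum]; rw [Finset.sum_comm]
    _ = ∑ y : L, if a * y + a ^ P * y ^ (P ^ 2) = 0 then (P ^ 4 : ℂ) else 0 := by
      refine Finset.sum_congr rfl fun y _ => ?_
      rw [h.bijective_pow.sum_comp fun z => ψ (z * (a * y + a ^ P * y ^ (P ^ 2))),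
        AddChar.sum_mulShift _ h.primitive, h.card_eq]
      split_ifs with hy
      · rw [hR y hy]; simp
      · simp
    _ = _ := by
      rw [← Finset.sum_filter, Finset.sum_const, nsmul_eq_mul, mul_comm]

/-- Every nonzero `(P + 1)`-th power is attained `P + 1` times, so the quotient is a sum of roots of
unity. -/
theorem isIntegral_powSum (h : FrobeniusChar ψ P) (a : L) :
    IsIntegral ℤ ((powSum ψ P a - 1) / (P + 1)) := by
  have h1 : powSum ψ P a - 1 = ∑ x : Lˣ, ψ (a * (x ^ (P + 1) : Lˣ)) := by
    rw [powSum_eq_one_add]; simp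
  have h2 : ∑ x : Lˣ, ψ (a * (x ^ (P + 1) : Lˣ)) =
      (P + 1 : ℂ) * ∑ z ∈ Finset.univ.image (fun x : Lˣ => x ^ (P + 1)), ψ (a * z) := by
    rw [Finset.sum_comp (fun z : Lˣ => ψ (a * z)) (fun x : Lˣ => x ^ (P + 1)), Finset.mul_sum]
    refine Finset.sum_congr rfl fun z hz => ?_
    obtain ⟨y, -, rfl⟩ := Finset.mem_image.1 hz
    rw [card_pow_eq_pow (by rw [h.card_units]; exact dvd_mul_right _ _)]
    simp
  have hP : (P + 1 : ℂ) ≠ 0 := by exact_mod_cast P.succ_ne_zero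
  rw [h1, h2, mul_div_cancel_left₀ _ hP]
  refine IsIntegral.sum _ fun z _ => ?_
  refine IsIntegral.of_pow (n := P ^ 4) (pow_pos (by have := h.one_lt; omega) _) ?_
  rw [← AddChar.map_nsmul_eq_pow, ← h.card_eq, ← Nat.card_eq_fintype_card, card_nsmul_eq_zero', AddChar.map_zero_eq_one]
  exact isIntegral_one

end FrobeniusChar

end CharacterSum

namespace FrobeniusChar

variable {L : Type*} [Field L] [Fintype L] [DecidableEq L] {ψ : AddChar L ℂ} {P : ℕ}

theorem powSum_pow (h : FrobeniusChar ψ P) (g : Lˣ) : powSum ψ P (g ^ (P + 1) : Lˣ) = -P ^ 3 := by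
  have e : powSum ψ P (g ^ (P + 1) : Lˣ) = powSum ψ P 1 := by
    rw [← powSum_mul_pow 1 g]; simp
  rw [e]
  obtain ⟨c, hc⟩ := h.exists_pow_eq_neg_one
  have hP := h.one_lt
  -- The nonzero part of the kernel is given by `y ^ (P ^ 2 - 1) = -1`, a coset of the `(P ^ 2 -
  -- 1)`-th roots of unity.
  have hcard : (Finset.univ.filter fun y : L => 1 * y + 1 ^ P * y ^ (P ^ 2) = 0).card = P ^ 2 := by
    have h1 : (Finset.univ.filter fun y : L => 1 * y + 1 ^ P * y ^ (P ^ 2) = 0) =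
        insert 0 ((Finset.univ.filter fun x : Lˣ => x ^ ((P - 1) * (P + 1)) =
          c ^ ((P - 1) * (P + 1))).map ⟨Units.val, Units.val_injective⟩) := by
      ext y
      simp only [Finset.mem_filter, Finset.mem_univ, true_and, Finset.mem_insert, Finset.mem_map,
        Function.Embedding.coeFn_mk, hc, one_pow, one_mul]
      have hsplit : y ^ (P ^ 2) = y * y ^ ((P - 1) * (P + 1)) := by
        rw [← pow_succ', h.sub_one_mul, Nat.sub_add_cancel (Nat.one_le_pow _ _ hP.le)]
      rw [hsplit]
      constructor
      · intro hy
        by_cases hy0 : y = 0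
        · exact Or.inl hy0
        · refine Or.inr ⟨Units.mk0 y hy0, Units.ext ?_, rfl⟩
          have : y * (1 + y ^ ((P - 1) * (P + 1))) = 0 := by linear_combination hy
          have := (mul_eq_zero.1 this).resolve_left hy0
          simp only [Units.val_pow_eq_pow_val, Units.val_mk0, Units.val_neg, Units.val_one]
          linear_combination this
      · rintro (rfl | ⟨x, hx, rfl⟩)
        · simp
        · have := congrArg Units.val hx
          simp only [Units.val_pow_eq_pow_val, Units.val_neg, Units.val_one] at this
          rw [this]; ring
    rw [h1, Finset.card_insert_of_notMem (by simp), Finset.card_map,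
      card_pow_eq_pow (by rw [h.card_units]; exact ⟨P ^ 2 + 1, by ring⟩), h.sub_one_mul,
      Nat.sub_add_cancel (Nat.one_le_pow _ _ hP.le)]
  have hsq := h.powSum_sq 1
  rw [hcard] at hsq
  have : (powSum ψ P 1 - P ^ 3) * (powSum ψ P 1 + P ^ 3) = 0 := by
    push_cast at hsq
    linear_combination hsq
  rcases mul_eq_zero.1 this with h1 | h1
  -- The witness comes from `P ^ 3 - 1 = (P ^ 2 - P + 1) (P + 1) - 2`.
  · refine (h.not_isIntegral_two_div (k := P ^ 2 - P + 1) (h.isIntegral_powSum 1) ?_).elim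
    push_cast
    linear_combination h1
  · linear_combination h1

/-- With `c ^ (P ^ 2 - 1) = -1`, a nonzero kernel element `y` would satisfy `(a (y / c) ^ (P + 1)) ^
(P - 1) = 1`, which makes `a` a `(P + 1)`-th power. So the kernel is trivial and the square is `P ^
4`. -/
theorem powSum_of_not_pow (h : FrobeniusChar ψ P) (a : Lˣ) (ha : ¬ ∃ g : Lˣ, g ^ (P + 1) = a) :
    powSum ψ P a = P ^ 2 := by
  obtain ⟨c, hc⟩ := h.exists_pow_eq_neg_one
  have hP := h.one_lt
  have hcard : (Finset.univ.filter fun y : L => (a : L) * y + a ^ P * y ^ (P ^ 2) = 0).card = 1 := by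
    rw [Finset.card_eq_one]
    refine ⟨0, ?_⟩
    ext y
    simp only [Finset.mem_filter, Finset.mem_univ, true_and, Finset.mem_singleton]
    constructor
    · intro hy
      by_contra hy0
      refine ha ?_
      obtain ⟨y, rfl⟩ : ∃ z : Lˣ, (z : L) = y := ⟨Units.mk0 y hy0, rfl⟩
      have h1 : (a * (y / c) ^ (P + 1)) ^ (P - 1) = 1 := by
        have h2 : a ^ (P - 1) * y ^ ((P - 1) * (P + 1)) = -1 := by
          have h3 : a ^ P * y ^ (P ^ 2) = -(a * y) := by
            refine Units.ext ?_
            push_cast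
            linear_combination hy
          have e1 : a ^ P = a ^ (P - 1) * a := by rw [← pow_succ, Nat.sub_add_cancel hP.le]
          have e2 : y ^ (P ^ 2) = y ^ ((P - 1) * (P + 1)) * y := by
            rw [← pow_succ, h.sub_one_mul, Nat.sub_add_cancel (Nat.one_le_pow _ _ hP.le)]
          rw [e1, e2] at h3
          refine mul_right_cancel (b := a * y) ?_
          rw [neg_one_mul, ← h3]
          simp only [mul_comm, mul_left_comm, mul_assoc]
        rw [mul_pow, ← pow_mul, mul_comm (P + 1), div_pow, hc, div_neg, div_one, mul_neg, h2, neg_neg]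
      obtain ⟨g, hg⟩ := exists_pow_eq_of_pow_eq_one (n := (P + 1) * (P ^ 2 + 1)) (m := P - 1)
        (by rw [h.card_units]; ring) h1
      refine ⟨g ^ (P ^ 2 + 1) / (y / c), ?_⟩
      rw [div_pow, ← pow_mul, mul_comm, hg, mul_div_cancel_right]
    · rintro rfl
      have hP0 : P ≠ 0 := by omega
      simp [hP0]
  have hsq := h.powSum_sq a
  rw [hcard] at hsq
  have : (powSum ψ P a - P ^ 2) * (powSum ψ P a + P ^ 2) = 0 := by
    push_cast at hsq
    linear_combination hsq
  rcases mul_eq_zero.1 this with h1 | h1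
  · linear_combination h1
  · refine (h.not_isIntegral_two_div (k := 1 - P) (h.isIntegral_powSum a) ?_).elim
    push_cast
    linear_combination h1

/-- The character sum over a set invariant under `(P + 1)`-th powers. -/
theorem sum_units_eq (h : FrobeniusChar ψ P) (D : Finset Lˣ)
    (hD : ∀ x ∈ D, ∀ g : Lˣ, x * g ^ (P + 1) ∈ D) (a : Lˣ) :
    ((P : ℂ) ^ 4 - 1) * ∑ x ∈ D, ψ (a * x) = D.card * (P ^ 2 - 1) -
      (P ^ 3 + P ^ 2) * ((Finset.univ.filter fun g : Lˣ => a⁻¹ * g ∈ D ∧ ∃ y : Lˣ, y ^ (P + 1) = g).card : ℂ) := by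
  have hcu : (Fintype.card Lˣ : ℂ) = P ^ 4 - 1 := by
    rw [Fintype.card_units, h.card_eq, Nat.cast_sub (Nat.one_le_pow _ _ (by have := h.one_lt; omega))]
    simp
  -- Averaging over the substitutions `x ↦ x g ^ (P + 1)` turns the inner sums into values of
  -- `powSum`, less the term at zero.
  have hperm : ∀ g : Lˣ, ∑ x ∈ D, ψ (a * x) = ∑ x ∈ D, ψ (a * x * g ^ (P + 1)) := fun g => by
    refine Finset.sum_bij' (fun x _ => x * g⁻¹ ^ (P + 1)) (fun x _ => x * g ^ (P + 1))
      (fun x hx => hD x hx _) (fun x hx => hD x hx _) ?_ ?_ ?_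
    · intro x _; rw [mul_assoc, ← mul_pow]; simp
    · intro x _; rw [mul_assoc, ← mul_pow]; simp
    · intro x _
      congr 1
      push_cast
      rw [mul_assoc, mul_assoc, ← mul_pow]; simp
  have hin : ∀ x : Lˣ, ∑ g : Lˣ, ψ (a * x * g ^ (P + 1)) =
      (P ^ 2 - 1) - if ∃ y : Lˣ, y ^ (P + 1) = a * x then (P ^ 3 + P ^ 2 : ℂ) else 0 := fun x => by
    have h1 : ∑ g : Lˣ, ψ (a * x * g ^ (P + 1)) = powSum ψ P ((a * x : Lˣ) : L) - 1 := by
      rw [powSum_eq_one_add]; simp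
    rw [h1]
    split_ifs with hx
    · obtain ⟨y, hy⟩ := hx
      rw [← hy, h.powSum_pow]; ring
    · rw [h.powSum_of_not_pow _ hx]; ring
  have hc : (Finset.univ.filter fun g : Lˣ => a⁻¹ * g ∈ D ∧ ∃ y : Lˣ, y ^ (P + 1) = g).card =
      (D.filter fun x => ∃ y : Lˣ, y ^ (P + 1) = a * x).card := by
    refine Finset.card_bij' (fun g _ => a⁻¹ * g) (fun x _ => a * x) ?_ ?_ ?_ ?_ <;>
      simp +contextual
  calc ((P : ℂ) ^ 4 - 1) * ∑ x ∈ D, ψ (a * x) = ∑ g : Lˣ, ∑ x ∈ D, ψ (a * x) := by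
        rw [Finset.sum_const, Finset.card_univ, nsmul_eq_mul, hcu]
    _ = ∑ x ∈ D, ∑ g : Lˣ, ψ (a * x * g ^ (P + 1)) := by
        rw [Finset.sum_congr rfl fun g _ => hperm g, Finset.sum_comm]
    _ = _ := by
        rw [Finset.sum_congr rfl fun x _ => hin x, Finset.sum_sub_distrib, Finset.sum_const, ← Finset.sum_filter,
          Finset.sum_const, hc]
        simp only [nsmul_eq_mul]; ring

end FrobeniusChar

/-! ### Unions of cyclotomic classes and their intersections with self-dual sets. -/

/-- For odd `d` only `1` is its own inverse among the `d`-th roots of unity. So `{1}` grows by pairs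
`x`, `x⁻¹` to any odd size; even sizes arise by dropping `1`. -/
theorem exists_inv_closed_card_eq {G : Type*} [CommGroup G] [IsCyclic G] [Fintype G]
    {d b : ℕ} (hd : d ∣ Nat.card G) (hodd : Odd d) (hb : b ≤ d) :
    ∃ J : Finset G, (∀ x ∈ J, x⁻¹ ∈ J) ∧ (∀ x ∈ J, x ^ d = 1) ∧ J.card = b := by
  classical
  obtain ⟨m, hm⟩ := hodd
  have key : ∀ k : ℕ, 2 * k + 1 ≤ d → ∃ J : Finset G, (1 : G) ∈ J ∧ (∀ x ∈ J, x⁻¹ ∈ J) ∧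
      (∀ x ∈ J, x ^ d = 1) ∧ J.card = 2 * k + 1 := by
    intro k
    induction k with
    | zero => intro _; exact ⟨{1}, by simp⟩
    | succ k ih =>
      intro hk
      obtain ⟨J, h1, hinv, hpow, hcard⟩ := ih (by omega)
      have hT := card_pow_eq_one_of_dvd_card hd
      obtain ⟨x, hx, hxJ⟩ := Finset.exists_mem_notMem_of_card_lt_card
        (s := J) (t := Finset.univ.filter fun x : G => x ^ d = 1) (by omega)
      have hx : x ^ d = 1 := by simpa using hx
      have hne : x⁻¹ ≠ x := by
        intro h
        have h2 : x ^ 2 = 1 := by rw [sq]; nth_rewrite 1 [← h]; simp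
        rw [hm, pow_succ, pow_mul, h2, one_pow, one_mul] at hx
        exact hxJ (hx ▸ h1)
      have hxJ' : x⁻¹ ∉ J := fun h => hxJ (by simpa using hinv _ h)
      refine ⟨insert x (insert x⁻¹ J), by simp [h1], ?_, ?_, ?_⟩
      · intro y hy
        simp only [Finset.mem_insert] at hy ⊢
        rcases hy with rfl | rfl | hy
        · simp
        · simp
        · exact Or.inr (Or.inr (hinv y hy))
      · intro y hy
        simp only [Finset.mem_insert] at hy
        rcases hy with rfl | rfl | hy
        · exact hx
        · rw [inv_pow, hx, inv_one]
        · exact hpow y hy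
      · rw [Finset.card_insert_of_notMem (by simp [hxJ, hne.symm]),
          Finset.card_insert_of_notMem hxJ', hcard]
        ring
  rcases Nat.even_or_odd' b with ⟨k, rfl | rfl⟩
  · obtain ⟨J, h1, hinv, hpow, hcard⟩ := key k (by omega)
    refine ⟨J.erase 1, fun x hx => ?_, fun x hx => hpow x (Finset.mem_of_mem_erase hx), ?_⟩
    · rw [Finset.mem_erase] at hx ⊢
      exact ⟨by simpa using hx.1, hinv x hx.2⟩
    · rw [Finset.card_erase_of_mem h1, hcard]; rfl
  · obtain ⟨J, -, h⟩ := key k hb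
    exact ⟨J, h⟩

theorem pow_sq_eq_self_of_dvd {G : Type*} [Group G] {x : G} {d P : ℕ} (hx : x ^ d = 1)
    (hd : d ∣ P + 1) (hP : 1 ≤ P) : x ^ (P ^ 2) = x := by
  have h1 : P ^ 2 = (P + 1) * (P - 1) + 1 := by
    obtain ⟨k, rfl⟩ := Nat.exists_eq_add_of_le hP
    simp only [Nat.add_sub_cancel_left]; ring
  obtain ⟨j, hj⟩ := hd
  rw [h1, pow_succ, hj, mul_assoc, pow_mul, hx, one_pow, one_mul]

namespace FrobeniusChar

variable {L : Type*} [Field L] [Fintype L] [DecidableEq L] {ψ : AddChar L ℂ} {P d n : ℕ}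

theorem card_filter_pow_mem (h : FrobeniusChar ψ P) (hdn : d * n = P ^ 4 - 1) (J : Finset Lˣ)
    (hpow : ∀ x ∈ J, x ^ d = 1) :
    (Finset.univ.filter (fun x : Lˣ => x ^ n ∈ J)).card = J.card * n := by
  have hcard : Nat.card Lˣ = d * n := by rw [h.card_units, hdn, pow_four_sub_one _ h.one_lt.le]
  rw [Finset.card_eq_sum_card_fiberwise (f := fun x : Lˣ => x ^ n) (t := J)
    (fun x hx => by simpa using hx), Finset.sum_const_nat]
  intro j hj
  obtain ⟨y, rfl⟩ := exists_pow_eq_of_pow_eq_one (n := n) (by rw [hcard, mul_comm]) (hpow j hj)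
  refine Eq.trans ?_ (card_pow_eq_pow (n := n) (by rw [hcard]; exact dvd_mul_left _ _) y)
  rw [Finset.filter_filter]
  congr 1
  ext x
  simp only [Finset.mem_filter, Finset.mem_univ, true_and]
  exact ⟨fun h => h.2, fun h => ⟨by rwa [h], h⟩⟩

/-- The character sum over the elements whose `n`-th power lies in a symmetric set `J` of `d`-th
roots of unity. -/
theorem sum_filter_pow_mem (h : FrobeniusChar ψ P) (hdn : d * n = P ^ 4 - 1) (hd : d ∣ P + 1)
    (J : Finset Lˣ) (hinv : ∀ x ∈ J, x⁻¹ ∈ J) (hpow : ∀ x ∈ J, x ^ d = 1) (a : Lˣ) :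
    ((P : ℂ) ^ 2 + 1) * ∑ x ∈ Finset.univ.filter (fun x : Lˣ => x ^ n ∈ J), ψ (a * x) =
      J.card * n - if a ^ n ∈ J then (P : ℂ) ^ 2 * (P ^ 2 + 1) else 0 := by
  have hP := h.one_lt
  have hcard : Nat.card Lˣ = d * n := by rw [h.card_units, hdn, pow_four_sub_one _ hP.le]
  have hN : ∀ g : Lˣ, (g ^ (P + 1)) ^ n = 1 := fun g => by
    obtain ⟨k, hk⟩ := hd
    rw [← pow_mul, hk, mul_right_comm, pow_mul, ← hcard, pow_card_eq_one', one_pow]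
  have hD := h.card_filter_pow_mem hdn J hpow
  have hcount : (Finset.univ.filter fun g : Lˣ => a⁻¹ * g ∈ Finset.univ.filter
      (fun x : Lˣ => x ^ n ∈ J) ∧ ∃ y : Lˣ, y ^ (P + 1) = g).card =
      if a ^ n ∈ J then (P - 1) * (P ^ 2 + 1) else 0 := by
    -- Powers of exponent `P + 1` stay inside a class, so only `(a⁻¹) ^ n ∈ J` matters;
    -- inverse-closedness turns this into `a ^ n ∈ J`.
    have hmem : ∀ g : Lˣ, (∃ y : Lˣ, y ^ (P + 1) = g) →
        (a⁻¹ * g ∈ Finset.univ.filter (fun x : Lˣ => x ^ n ∈ J) ↔ a ^ n ∈ J) := by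
      rintro g ⟨y, rfl⟩
      rw [Finset.mem_filter, mul_pow, hN, mul_one, inv_pow]
      exact ⟨fun h => by simpa using hinv _ h.2, fun h => ⟨Finset.mem_univ _, hinv _ h⟩⟩
    split_ifs with ha
    · have hm : (P - 1) * (P ^ 2 + 1) ∣ Nat.card Lˣ := by rw [h.card_units]; exact dvd_mul_left _ _
      rw [← card_pow_eq_one_of_dvd_card hm]
      congr 1
      ext g
      simp only [Finset.mem_filter, Finset.mem_univ, true_and]
      constructor
      · rintro ⟨-, y, rfl⟩
        rw [← pow_mul, ← h.card_units, pow_card_eq_one']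
      · intro hg
        have hy := exists_pow_eq_of_pow_eq_one h.card_units.symm hg
        have := (hmem g hy).2 ha
        simp only [Finset.mem_filter, Finset.mem_univ, true_and] at this
        exact ⟨this, hy⟩
    · rw [Finset.card_eq_zero, Finset.filter_eq_empty_iff]
      rintro g - ⟨hg, hy⟩
      exact ha ((hmem g hy).1 hg)
  have hs := h.sum_units_eq (Finset.univ.filter (fun x : Lˣ => x ^ n ∈ J)) (fun x hx g => by
    rw [Finset.mem_filter] at hx ⊢
    exact ⟨Finset.mem_univ _, by rw [mul_pow, hN, mul_one]; exact hx.2⟩) a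
  rw [hcount, hD] at hs
  have h0 : (P : ℂ) ^ 2 - 1 ≠ 0 := by
    rw [sub_ne_zero]
    have : 1 < P ^ 2 := Nat.one_lt_pow two_ne_zero hP
    exact_mod_cast this.ne'
  refine mul_left_cancel₀ h0 ?_
  rw [← mul_assoc, show ((P : ℂ) ^ 2 - 1) * (P ^ 2 + 1) = P ^ 4 - 1 by ring, hs]
  split_ifs
  · push_cast [Nat.cast_sub hP.le]; ring
  · push_cast; ring

/-- A self-dual subset meets the set of elements with `n`-th power in `J` in a constant number of
points. -/
theorem card_filter_mem (h : FrobeniusChar ψ P) (hdn : d * n = P ^ 4 - 1) (hd : d ∣ P + 1)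
    (J : Finset Lˣ) (hinv : ∀ x ∈ J, x⁻¹ ∈ J) (hpow : ∀ x ∈ J, x ^ d = 1) {lam : Lˣ}
    (hlam : lam ^ n = 1) (U : Finset L) (h0 : 0 ∈ U) (hU : U.card = P ^ 2)
    (hdual : ∀ x : L, ∑ u ∈ U, ψ (lam * u ^ (P ^ 2) * x) = if x ∈ U then (P : ℂ) ^ 2 else 0) :
    (Finset.univ.filter fun x : Lˣ => x ^ n ∈ J ∧ (x : L) ∈ U).card * d = J.card * (P ^ 2 - 1) := by
  have hP := h.one_lt
  set D := Finset.univ.filter (fun x : Lˣ => x ^ n ∈ J) with hDdef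
  have hA : (Finset.univ.filter fun x : Lˣ => x ^ n ∈ J ∧ (x : L) ∈ U) =
      D.filter fun x : Lˣ => (x : L) ∈ U := by rw [hDdef, Finset.filter_filter]
  rw [hA]
  set A := (D.filter fun x : Lˣ => (x : L) ∈ U).card with hAdef
  have hcard : Nat.card Lˣ = d * n := by rw [h.card_units, hdn, pow_four_sub_one _ hP.le]
  have hterm : ∀ u : Lˣ, ((P : ℂ) ^ 2 + 1) * ∑ x ∈ D, ψ (lam * (u : L) ^ (P ^ 2) * x) =
      J.card * n - if u ∈ D then (P : ℂ) ^ 2 * (P ^ 2 + 1) else 0 := fun u => by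
    have h1 := h.sum_filter_pow_mem hdn hd J hinv hpow (lam * u ^ (P ^ 2))
    -- Neither `lam` nor the conjugation changes the class of `u`, since `P ^ 2` is `1` modulo `d`.
    have h2 : (lam * u ^ (P ^ 2)) ^ n = u ^ n := by
      rw [mul_pow, hlam, one_mul, ← pow_mul, mul_comm, pow_mul]
      refine pow_sq_eq_self_of_dvd ?_ hd hP.le
      rw [← pow_mul, mul_comm, ← hcard, pow_card_eq_one']
    rw [h2] at h1
    simpa [hDdef] using h1
  have hzero : ∑ x ∈ D, ψ (lam * (0 : L) ^ (P ^ 2) * x) = D.card := by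
    have : P ≠ 0 := by omega
    simp [this]
  have hDcard : D.card = J.card * n := h.card_filter_pow_mem hdn J hpow
  have hUsum : ((P : ℂ) ^ 2 + 1) * ∑ u ∈ U.erase 0, ∑ x ∈ D, ψ (lam * u ^ (P ^ 2) * x) =
      (P ^ 2 - 1) * (J.card * n) - P ^ 2 * (P ^ 2 + 1) * A := by
    have hcardU : ((U.erase 0).card : ℂ) = P ^ 2 - 1 := by
      rw [Finset.card_erase_of_mem h0, hU, Nat.cast_sub (Nat.one_le_pow _ _ hP.le)]
      simp
    have hAU : (D.map ⟨Units.val, Units.val_injective⟩ ∩ U.erase 0).card = A := by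
      rw [hAdef, ← Finset.card_map (⟨Units.val, Units.val_injective⟩ : Lˣ ↪ L)]
      congr 1
      ext x
      simp only [Finset.mem_inter, Finset.mem_map, Finset.mem_erase, Finset.mem_filter,
        Function.Embedding.coeFn_mk]
      constructor
      · rintro ⟨⟨y, hy, rfl⟩, -, hyU⟩
        exact ⟨y, ⟨hy, hyU⟩, rfl⟩
      · rintro ⟨y, ⟨hy, hyU⟩, rfl⟩
        exact ⟨⟨y, hy, rfl⟩, y.ne_zero, hyU⟩
    have hval : ∀ u ∈ U.erase 0, ((P : ℂ) ^ 2 + 1) * ∑ x ∈ D, ψ (lam * u ^ (P ^ 2) * x) =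
        J.card * n - if u ∈ D.map ⟨Units.val, Units.val_injective⟩ then
          (P : ℂ) ^ 2 * (P ^ 2 + 1) else 0 := fun u hu => by
      obtain ⟨u, rfl⟩ : ∃ z : Lˣ, (z : L) = u := ⟨Units.mk0 u (Finset.ne_of_mem_erase hu), rfl⟩
      rw [hterm]
      congr 2
      simp
    rw [Finset.mul_sum, Finset.sum_congr rfl hval, Finset.sum_sub_distrib, Finset.sum_const,
      ← Finset.sum_filter, Finset.sum_const, nsmul_eq_mul, nsmul_eq_mul, hcardU,
      Finset.filter_mem_eq_inter, Finset.inter_comm, hAU]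
    ring
  have htotal : ∑ u ∈ U, ∑ x ∈ D, ψ (lam * u ^ (P ^ 2) * x) = P ^ 2 * A := by
    rw [Finset.sum_comm, Finset.sum_congr rfl fun (x : Lˣ) _ => hdual x, ← Finset.sum_filter,
      Finset.sum_const, nsmul_eq_mul, mul_comm]
  rw [← Finset.add_sum_erase _ _ h0, hzero, hDcard] at htotal
  -- The two evaluations contain `P ^ 2 * A` with opposite signs, so `A` does not cancel; this is
  -- the source of the factor `1 / 2`.
  have hfin : (P : ℂ) ^ 2 * ((P ^ 2 + 1) * A) = P ^ 2 * (J.card * n) := by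
    push_cast at htotal
    linear_combination (1 / 2) * hUsum - (1 / 2) * ((P : ℂ) ^ 2 + 1) * htotal
  have hfin' : (P ^ 2 + 1) * A = J.card * n := by
    have hP0 : (P : ℂ) ^ 2 ≠ 0 := pow_ne_zero _ (by exact_mod_cast (by omega : P ≠ 0))
    exact_mod_cast mul_left_cancel₀ hP0 hfin
  refine Nat.eq_of_mul_eq_mul_left (Nat.succ_pos (P ^ 2)) ?_
  rw [Nat.succ_eq_add_one, ← mul_assoc, hfin', mul_assoc, mul_comm n, hdn, pow_four_sub_one _ hP.le,
    ← h.sub_one_mul]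
  ring

end FrobeniusChar

/-! ### The trace character. -/

section TraceChar

variable (p : ℕ) [Fact p.Prime] (L : Type*) [Field L] [Algebra (ZMod p) L]

/-- The additive character of a finite field obtained from the trace to the prime field. -/
noncomputable def traceChar : AddChar L ℂ :=
  (ZMod.stdAddChar (N := p)).compAddMonoidHom (Algebra.trace (ZMod p) L).toAddMonoidHom

variable {p L}

theorem traceChar_apply (x : L) :
    traceChar p L x = ZMod.stdAddChar (Algebra.trace (ZMod p) L x) := rfl

theorem traceChar_eq_one_iff (x : L) : traceChar p L x = 1 ↔ Algebra.trace (ZMod p) L x = 0 := by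
  rw [traceChar_apply, ← AddChar.map_zero_eq_one (ZMod.stdAddChar (N := p)),
    ZMod.injective_stdAddChar.eq_iff]

theorem exists_trace_mul_ne_zero {K E : Type*} [Field K] [Field E] [Algebra K E]
    [FiniteDimensional K E] [Algebra.IsSeparable K E] {a : E} (ha : a ≠ 0) :
    ∃ x : E, Algebra.trace K E (a * x) ≠ 0 := by
  by_contra! hc
  exact ha ((traceForm_nondegenerate K E).1 a hc)

variable [Fintype L]

theorem traceChar_isPrimitive : (traceChar p L).IsPrimitive := by
  intro a ha hc
  obtain ⟨x, hx⟩ := exists_trace_mul_ne_zero (K := ZMod p) ha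
  have := DFunLike.congr_fun hc x
  rw [AddChar.mulShift_apply, AddChar.one_apply, traceChar_eq_one_iff] at this
  exact hx this

theorem traceChar_pow (x : L) (k : ℕ) : traceChar p L (x ^ p ^ k) = traceChar p L x := by
  induction k with
  | zero => simp
  | succ k ih =>
    rw [pow_succ, pow_mul, ← ih, traceChar_apply, traceChar_apply]
    congr 1
    have := Algebra.trace_eq_of_algEquiv (FiniteField.frobeniusAlgEquivOfAlgebraic (ZMod p) L) (x ^ p ^ k)
    simpa [ZMod.card] using this

theorem traceChar_frobeniusChar {k : ℕ} (hp : Odd p) (hk : 0 < k)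
    (hcard : Fintype.card L = (p ^ k) ^ 4) : FrobeniusChar (traceChar p L) (p ^ k) where
  primitive := traceChar_isPrimitive
  card_eq := hcard
  odd := hp.pow
  one_lt := Nat.one_lt_pow hk.ne' (Fact.out : p.Prime).one_lt
  add_pow x y := by
    have : CharP L p := charP_of_injective_algebraMap (algebraMap (ZMod p) L).injective p
    exact add_pow_char_pow x y p k
  map_pow x := traceChar_pow x k

end TraceChar

/-! ### The field model of the symplectic space. -/

section TwistedForm

variable {F : Type*} {L : Type*} [Field F] [Field L] [Algebra F L]

/-- The form `(x, y) ↦ Tr (lam * x * σ y)`. -/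
noncomputable def twistedForm (lam : L) (σ : L →ₐ[F] L) : LinearMap.BilinForm F L :=
  LinearMap.mk₂ F (fun x y => Algebra.trace F L (lam * σ y * x))
    (fun x x' y => by rw [mul_add, map_add])
    (fun c x y => by rw [mul_smul_comm, map_smul])
    (fun x y y' => by rw [map_add, mul_add, add_mul, map_add])
    (fun c x y => by rw [map_smul, mul_smul_comm, smul_mul_assoc, map_smul])

theorem twistedForm_apply (lam : L) (σ : L →ₐ[F] L) (x y : L) :
    twistedForm lam σ x y = Algebra.trace F L (lam * σ y * x) := rfl

/-- The trace is `σ`-invariant, while `σ` negates `lam * σ x * x`. -/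
theorem twistedForm_isAlt (h2 : (2 : F) ≠ 0) {lam : L} {σ : L ≃ₐ[F] L} (hσ : ∀ x, σ (σ x) = x)
    (hlam : σ lam = -lam) : (twistedForm lam (σ : L →ₐ[F] L)).IsAlt := fun x => by
  have h1 := Algebra.trace_eq_of_algEquiv σ (lam * σ x * x)
  rw [map_mul σ, map_mul σ, hσ, hlam, show -lam * x * σ x = -(lam * σ x * x) by ring, map_neg] at h1
  rw [twistedForm_apply]
  have : (2 : F) * Algebra.trace F L (lam * σ x * x) = 0 := by linear_combination -h1
  exact (mul_eq_zero.1 this).resolve_left h2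

theorem twistedForm_nondegenerate [FiniteDimensional F L] [Algebra.IsSeparable F L] {lam : L} (h0 : lam ≠ 0) {σ : L ≃ₐ[F] L}
    (halt : (twistedForm lam (σ : L →ₐ[F] L)).IsAlt) :
    (twistedForm lam (σ : L →ₐ[F] L)).Nondegenerate := by
  have hr : (twistedForm lam (σ : L →ₐ[F] L)).SeparatingRight := by
    intro y hy
    by_contra hy0
    obtain ⟨x, hx⟩ := exists_trace_mul_ne_zero (K := F) (a := lam * σ y)
      (mul_ne_zero h0 (by simpa using hy0))
    exact hx (hy x)
  refine ⟨fun x hx => hr x fun y => ?_, hr⟩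
  exact (halt.isRefl x y) (hx y)

end TwistedForm

section Model

variable {F : Type*} {L : Type*} [Field F] [Field L] [Algebra F L] [Fintype L]
  {p : ℕ} [Fact p.Prime] [Algebra (ZMod p) F] [Algebra (ZMod p) L] [IsScalarTower (ZMod p) F L]

theorem exists_traceChar_smul_ne_one [Finite F] {w : L} (hw : Algebra.trace F L w ≠ 0) :
    ∃ c : F, traceChar p L (c • w) ≠ 1 := by
  obtain ⟨c, hc⟩ := exists_trace_mul_ne_zero (K := ZMod p) hw
  refine ⟨c, ?_⟩
  rwa [Ne, traceChar_eq_one_iff, ← Algebra.trace_trace (S := F), map_smul, smul_eq_mul, mul_comm]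

/-- Orthogonality of characters on `U`. If `x ∉ U`, some `u ∈ U` has nonzero trace to `F`; a scalar
multiple of it makes the character nontrivial, and translating by that multiple kills the sum. -/
theorem sum_traceChar_twistedForm [Finite F] (lam : L) (σ : L →ₐ[F] L) (U : Submodule F L)
    [DecidablePred (· ∈ U)] (hU : ∀ x, x ∈ U ↔ ∀ u ∈ U, twistedForm lam σ x u = 0) (x : L) :
    ∑ u ∈ Finset.univ.filter (· ∈ U), traceChar p L (lam * σ u * x) =
      if x ∈ U then ((Finset.univ.filter (· ∈ U)).card : ℂ) else 0 := by
  split_ifs with hx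
  · rw [Finset.sum_congr rfl (g := fun _ => 1), Finset.sum_const, nsmul_one]
    intro u hu
    have hu : u ∈ U := by simpa using hu
    rw [traceChar_eq_one_iff, ← Algebra.trace_trace (S := F), ← twistedForm_apply, (hU x).1 hx u hu,
      map_zero]
  · rw [hU] at hx
    push Not at hx
    obtain ⟨u, hu, hne⟩ := hx
    obtain ⟨c, hc⟩ := exists_traceChar_smul_ne_one (p := p) (w := lam * σ u * x) hne
    have hcu : c • u ∈ U := U.smul_mem c hu
    have hshift : ∑ u ∈ Finset.univ.filter (· ∈ U), traceChar p L (lam * σ u * x) =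
        ∑ v ∈ Finset.univ.filter (· ∈ U),
          traceChar p L (lam * σ v * x) * traceChar p L (c • (lam * σ u * x)) := by
      refine Finset.sum_bij' (fun v _ => v - c • u) (fun v _ => v + c • u) ?_ ?_ ?_ ?_ ?_
      · intro v hv; simpa using U.sub_mem (by simpa using hv) hcu
      · intro v hv; simpa using U.add_mem (by simpa using hv) hcu
      · simp
      · simp
      · intro v _
        rw [← AddChar.map_add_eq_mul, map_sub, map_smul]
        congr 1
        simp only [Algebra.smul_def]; ring
    rw [← Finset.sum_mul] at hshift
    have : (∑ u ∈ Finset.univ.filter (· ∈ U), traceChar p L (lam * σ u * x)) *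
        (traceChar p L (c • (lam * σ u * x)) - 1) = 0 := by linear_combination -hshift
    exact (mul_eq_zero.1 this).resolve_right (sub_ne_zero.2 hc)

end Model

theorem card_of_orthogonal_eq {F V : Type*} [Field F] [Finite F] [AddCommGroup V] [Module F V]
    {p e r : ℕ} {B : LinearMap.BilinForm F V} (hB : IsSymplecticForm p e r B) (hr : 0 < r)
    {U : Submodule F V} (hU : B.orthogonal U = U) : Nat.card U = p ^ (e * r) := by
  have hfd : FiniteDimensional F V :=
    Module.finite_of_finrank_pos (by rw [hB.finrank_eq]; omega)
  have h1 := LinearMap.BilinForm.finrank_orthogonal hB.nondegenerate U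
  have h2 := U.finrank_le
  rw [hU, hB.finrank_eq] at h1
  rw [hB.finrank_eq] at h2
  rw [Module.natCard_eq_pow_finrank (K := F), hB.card_eq, ← pow_mul,
    show Module.finrank F U = r by omega]

/-- A symplectic form on an extension field together with sets of nonzero vectors, invariant under
scalars, that meet all self-orthogonal subspaces equally often. -/
theorem exists_form_and_sets {p e r l d : ℕ} [Fact p.Prime] (hp : Odd p) (hl : 0 < l)
    (he : e * r = 2 * l) (hd : Odd d) (hdN : d ∣ p ^ l + 1) (hdm : d * (p ^ e - 1) ∣ p ^ (e * r) - 1)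
    {F L : Type*} [Field F] [Field L] [Algebra F L] (hF : Nat.card F = p ^ e)
    (hfin : Module.finrank F L = 2 * r) :
    ∃ B : LinearMap.BilinForm F L, IsSymplecticForm p e r B ∧ ∀ b ≤ d, ∃ D : Set L, 0 ∉ D ∧
      (∀ c : F, c ≠ 0 → ∀ x ∈ D, c • x ∈ D) ∧ ∀ U : Submodule F L, B.orthogonal U = U →
        {x ∈ D | x ∈ U}.ncard * d = b * (p ^ (e * r) - 1) := by
  classical
  have hpp : p.Prime := Fact.out
  have he0 : e ≠ 0 := by rintro rfl; omega
  have hr0 : 0 < r := Nat.pos_of_ne_zero (by rintro rfl; omega)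
  have : Finite F := Nat.finite_of_card_ne_zero (by rw [hF]; exact (pow_pos hpp.pos _).ne')
  have : FiniteDimensional F L := Module.finite_of_finrank_pos (by omega)
  have : Finite L := Module.finite_of_finite F
  let _ := Fintype.ofFinite F
  let _ := Fintype.ofFinite L
  have : CharP F p := charP_of_card_eq_prime_pow (by rw [← Nat.card_eq_fintype_card, hF])
  have : CharP L p := charP_of_injective_algebraMap (algebraMap F L).injective p
  let _ : Algebra (ZMod p) F := ZMod.algebra F p
  let _ : Algebra (ZMod p) L := ZMod.algebra L p
  have : IsScalarTower (ZMod p) F L := IsScalarTower.of_algebraMap_eq' (RingHom.ext_zmod _ _)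
  have hLcard : Fintype.card L = (p ^ l) ^ 4 := by
    rw [← Nat.card_eq_fintype_card, Module.natCard_eq_pow_finrank (K := F), hF, hfin, ← pow_mul,
      ← pow_mul]
    congr 1
    linarith
  have hψ : FrobeniusChar (traceChar p L) (p ^ l) := traceChar_frobeniusChar hp hl hLcard
  have hP := hψ.one_lt
  have hPsq : p ^ (e * r) = (p ^ l) ^ 2 := by rw [he, ← pow_mul, mul_comm]
  obtain ⟨n, hn⟩ : d ∣ (p ^ l) ^ 4 - 1 := by
    rw [pow_four_sub_one _ hP.le]; exact hdN.mul_right _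
  have hcardU : Nat.card Lˣ = d * n := by rw [hψ.card_units, ← hn, pow_four_sub_one _ hP.le]
  -- As `L` has degree `2 * r` over `F`, the `r`-th power of Frobenius is an involution.
  let σ : L ≃ₐ[F] L := FiniteField.frobeniusAlgEquivOfAlgebraic F L ^ r
  have hσ : ∀ x, σ x = x ^ ((p ^ l) ^ 2) := fun x => by
    rw [← hPsq, pow_mul, ← hF, Nat.card_eq_fintype_card, AlgEquiv.coe_pow,
      FiniteField.coe_frobeniusAlgEquivOfAlgebraic_iterate]
  obtain ⟨c, hc⟩ := hψ.exists_pow_eq_neg_one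
  rw [hψ.sub_one_mul] at hc
  -- Taking `λ = c ^ d` keeps the sign because `d` is odd, and gives `λ ^ n = 1` because `d * n` is
  -- the order of `Lˣ`.
  have hlam : (c ^ d) ^ ((p ^ l) ^ 2) = -(c ^ d) := by
    rw [← Nat.sub_add_cancel (Nat.one_le_pow 2 _ hP.le), pow_succ, ← pow_mul, mul_comm d, pow_mul, hc,
      hd.neg_one_pow, neg_one_mul]
  have hlamn : (c ^ d) ^ n = 1 := by rw [← pow_mul, ← hcardU, pow_card_eq_one']
  have h2 : (2 : F) ≠ 0 := by
    have : ringChar F ≠ 2 := by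
      rw [ringChar.eq F p]; rintro rfl; exact absurd hp (by decide)
    exact Ring.two_ne_zero this
  have halt : (twistedForm ((c ^ d : Lˣ) : L) (σ : L →ₐ[F] L)).IsAlt :=
    twistedForm_isAlt h2 (fun x => by
      rw [hσ, hσ, ← pow_mul, ← pow_add, ← hLcard, FiniteField.pow_card])
      (by rw [hσ, ← Units.val_pow_eq_pow_val, hlam, Units.val_neg])
  have hB : IsSymplecticForm p e r (twistedForm ((c ^ d : Lˣ) : L) (σ : L →ₐ[F] L)) :=
    ⟨hF, hfin, halt, twistedForm_nondegenerate (Units.ne_zero _) halt⟩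
  refine ⟨_, hB, fun b hb => ?_⟩
  obtain ⟨J, hinv, hpow, hJ⟩ := exists_inv_closed_card_eq (G := Lˣ) ⟨n, hcardU⟩ hd hb
  refine ⟨Units.val '' {x : Lˣ | x ^ n ∈ J}, ?_, ?_, ?_⟩
  · rintro ⟨x, -, hx⟩; exact x.ne_zero hx
  · rintro a ha _ ⟨x, hx, rfl⟩
    refine ⟨Units.map (algebraMap F L).toMonoidHom (Units.mk0 a ha) * x, ?_, ?_⟩
    -- Scalars have trivial `n`-th power: `d * (p ^ e - 1)` divides `P ^ 2 - 1`, hence `P ^ 4 - 1 =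
    -- d * n`.
    · have hdvd : p ^ e - 1 ∣ n := by
        have h1 : d * (p ^ e - 1) ∣ d * n := by
          rw [← hn, show (p ^ l) ^ 4 = ((p ^ l) ^ 2) ^ 2 by ring, ← hPsq]
          exact hdm.trans (by simpa using Nat.sub_dvd_pow_sub_pow (p ^ (e * r)) 1 2)
        exact Nat.dvd_of_mul_dvd_mul_left hd.pos h1
      have hone : (Units.mk0 a ha) ^ n = 1 := by
        obtain ⟨k, rfl⟩ := hdvd
        have : (Units.mk0 a ha) ^ (p ^ e - 1) = 1 := by
          rw [← hF, ← Nat.card_units, pow_card_eq_one']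
        rw [pow_mul, this, one_pow]
      rw [Set.mem_ofPred_eq, mul_pow, ← map_pow, hone, map_one, one_mul]
      exact hx
    · simp [Algebra.smul_def]
  · intro U hU
    have hUmem : ∀ x, x ∈ U ↔ ∀ u ∈ U, twistedForm ((c ^ d : Lˣ) : L) (σ : L →ₐ[F] L) x u = 0 := by
      intro x
      nth_rewrite 1 [← hU]
      rw [LinearMap.BilinForm.mem_orthogonal_iff]
      exact ⟨fun h u hu => halt.isRefl _ _ (h u hu), fun h u hu => halt.isRefl _ _ (h u hu)⟩
    have hUcard : (Finset.univ.filter (· ∈ U)).card = (p ^ l) ^ 2 := by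
      rw [← hPsq, ← card_of_orthogonal_eq hB hr0 hU, Nat.card_eq_fintype_card, Fintype.card_subtype]
    have hsum := sum_traceChar_twistedForm (p := p) _ _ U hUmem
    have := hψ.card_filter_mem hn.symm hdN J hinv hpow hlamn (Finset.univ.filter (· ∈ U)) (by simp)
      hUcard (fun x => by
        have h := hsum x
        rw [hUcard] at h
        simpa [hσ] using h)
    rw [hJ, ← hPsq] at this
    rw [← this]
    congr 1
    rw [← Set.ncard_coe_finset, ← Set.ncard_image_of_injective _ Units.val_injective]
    congr 1
    ext x
    simp only [Set.mem_ofPred_eq, Set.mem_image, Finset.coe_filter, Finset.mem_univ, true_and,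
      Finset.mem_filter]
    constructor
    · rintro ⟨⟨y, hy, rfl⟩, hyU⟩; exact ⟨y, ⟨hy, hyU⟩, rfl⟩
    · rintro ⟨y, ⟨hy, hyU⟩, rfl⟩; exact ⟨⟨y, hy, rfl⟩, hyU⟩

/-! ### Isometry of symplectic spaces, maximals, and passage from vectors to points. -/

section Symplectic

variable {F : Type*} [Field F]

/-- A hyperbolic plane splits off a nonzero symplectic space. -/
theorem exists_hyperbolic_split {V : Type*} [AddCommGroup V] [Module F V] [Nontrivial V]
    {B : LinearMap.BilinForm F V} (hB : B.IsAlt) (hnd : B.Nondegenerate) :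
    ∃ (K : Submodule F V) (f : ((F × F) × K) ≃ₗ[F] V), (B.restrict K).Nondegenerate ∧
      ∀ s t, B (f s) (f t) = s.1.1 * t.1.2 - s.1.2 * t.1.1 + B s.2 t.2 := by
  obtain ⟨x, hx⟩ := exists_ne (0 : V)
  obtain ⟨y, hxy⟩ : ∃ y, B x y = 1 := by
    obtain ⟨z, hz⟩ : ∃ z, B x z ≠ 0 := by
      by_contra! hc; exact hx (hnd.1 x hc)
    exact ⟨(B x z)⁻¹ • z, by rw [map_smul, smul_eq_mul, inv_mul_cancel₀ hz]⟩
  have hyx : B y x = -1 := by rw [← hB.neg_eq, hxy]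
  have hxx : B x x = 0 := hB x
  have hyy : B y y = 0 := hB y
  let K : Submodule F V := LinearMap.ker (B x) ⊓ LinearMap.ker (B y)
  have hK : ∀ k : K, B x k = 0 ∧ B y k = 0 ∧ B k x = 0 ∧ B k y = 0 := fun k => by
    have h := k.2
    simp only [K, Submodule.mem_inf, LinearMap.mem_ker] at h
    exact ⟨h.1, h.2, hB.isRefl _ _ h.1, hB.isRefl _ _ h.2⟩
  let g : ((F × F) × K) →ₗ[F] V :=
    ((LinearMap.toSpanSingleton F V x).coprod (LinearMap.toSpanSingleton F V y)).coprod K.subtype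
  have hg : ∀ s, g s = s.1.1 • x + s.1.2 • y + s.2 := fun s => rfl
  have hform : ∀ s t, B (g s) (g t) = s.1.1 * t.1.2 - s.1.2 * t.1.1 + B s.2 t.2 := fun s t => by
    obtain ⟨h1, h2, -, -⟩ := hK t.2
    obtain ⟨-, -, h3, h4⟩ := hK s.2
    rw [hg, hg]
    simp only [map_add, map_smul, LinearMap.add_apply, LinearMap.smul_apply, smul_eq_mul, hxx, hxy,
      hyx, hyy, h1, h2, h3, h4]
    ring
  have hsurj : Function.Surjective g := fun v => by
    refine ⟨((-B y v, B x v), ⟨v + B y v • x - B x v • y, ?_⟩), ?_⟩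
    · simp [K, hxx, hxy, hyx, hyy]
    · rw [hg]; module
  have hinj : Function.Injective g := by
    rw [← LinearMap.ker_eq_bot, LinearMap.ker_eq_bot']
    intro s hs
    have h1 := hform ((1, 0), 0) s
    have h2 := hform ((0, 1), 0) s
    rw [hs] at h1 h2
    simp only [map_zero, one_mul, zero_mul, Submodule.coe_zero, LinearMap.zero_apply, add_zero,
      sub_zero, zero_sub] at h1 h2
    have h3 : s.1.1 = 0 := by linear_combination h2
    rw [hg, h3, ← h1] at hs
    refine Prod.ext (Prod.ext h3 h1.symm) (Subtype.ext ?_)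
    simpa using hs
  refine ⟨K, LinearEquiv.ofBijective g ⟨hinj, hsurj⟩, ?_, hform⟩
  have hl : (B.restrict K).SeparatingLeft := fun k hk => by
    refine Subtype.ext (hnd.1 _ fun v => ?_)
    obtain ⟨t, rfl⟩ := hsurj v
    obtain ⟨-, -, h3, h4⟩ := hK k
    rw [hg, map_add, map_add, map_smul, map_smul, h3, h4]
    simpa using hk t.2
  refine ⟨hl, fun k hk => hl k fun k' => ?_⟩
  exact hB.isRefl _ _ (hk k')

/-- Symplectic spaces of the same finite dimension are isometric. -/
theorem exists_symplectic_isometry {V : Type*} {W : Type*} [AddCommGroup V] [Module F V]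
    [AddCommGroup W] [Module F W] [FiniteDimensional F V] [FiniteDimensional F W]
    {B : LinearMap.BilinForm F V} {B' : LinearMap.BilinForm F W} (hB : B.IsAlt)
    (hnd : B.Nondegenerate) (hB' : B'.IsAlt) (hnd' : B'.Nondegenerate)
    (hfin : Module.finrank F V = Module.finrank F W) :
    ∃ f : V ≃ₗ[F] W, ∀ x y, B' (f x) (f y) = B x y := by
  induction hn : Module.finrank F V using Nat.strong_induction_on generalizing V W with
  | _ n ih =>
    rcases Nat.eq_zero_or_pos n with rfl | hpos
    · have := Module.finrank_zero_iff.1 hn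
      refine ⟨LinearEquiv.ofFinrankEq V W hfin, fun x y => ?_⟩
      rw [Subsingleton.elim x 0]; simp
    · have : Nontrivial V := Module.nontrivial_of_finrank_pos (R := F) (by omega)
      have : Nontrivial W := Module.nontrivial_of_finrank_pos (R := F) (by omega)
      obtain ⟨K, f, hK, hf⟩ := exists_hyperbolic_split hB hnd
      obtain ⟨K', f', hK', hf'⟩ := exists_hyperbolic_split hB' hnd'
      have e1 := f.finrank_eq
      have e2 := f'.finrank_eq
      rw [Module.finrank_prod, Module.finrank_prod, Module.finrank_self] at e1 e2
      obtain ⟨g, hg⟩ := ih (Module.finrank F K) (by omega) (B := B.restrict K) (B' := B'.restrict K')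
        (fun x => hB x) hK (fun x => hB' x) hK' (by omega) rfl
      refine ⟨f.symm ≪≫ₗ ((LinearEquiv.refl F (F × F)).prodCongr g) ≪≫ₗ f', fun x y => ?_⟩
      obtain ⟨s, rfl⟩ := f.surjective x
      obtain ⟨t, rfl⟩ := f.surjective y
      simp only [LinearEquiv.trans_apply, LinearEquiv.symm_apply_apply, hf, hf']
      have := hg s.2 t.2
      simp only [LinearMap.BilinForm.restrict_apply, LinearMap.domRestrict_apply] at this
      simpa using this

/-- Any vector orthogonal to `U` is itself isotropic, so adjoining it keeps `U` totally isotropic;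
maximality puts it in `U`. -/
theorem IsGenerator.orthogonal_eq {V : Type*} [AddCommGroup V] [Module F V] [FiniteDimensional F V]
    {B : LinearMap.BilinForm F V} (hB : B.IsAlt) {U : Submodule F V} (hU : IsGenerator B U) :
    B.orthogonal U = U := by
  refine le_antisymm (fun x hx => ?_) fun x hx y hy => hU.1 y hy x hx
  have hx' : ∀ u ∈ U, B u x = 0 := hx
  have hiso : IsTotallyIsotropic B (U ⊔ Submodule.span F {x}) := by
    intro v hv w hw
    obtain ⟨u, hu, _, hx1, rfl⟩ := Submodule.mem_sup.1 hv
    obtain ⟨u', hu', _, hx2, rfl⟩ := Submodule.mem_sup.1 hw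
    obtain ⟨a, rfl⟩ := Submodule.mem_span_singleton.1 hx1
    obtain ⟨b, rfl⟩ := Submodule.mem_span_singleton.1 hx2
    have h1 : B x u' = 0 := hB.isRefl _ _ (hx' u' hu')
    have h2 : B x x = 0 := hB x
    simp [hU.1 u hu u' hu', hx' u hu, h1, h2]
  have := Submodule.eq_of_le_of_finrank_le (le_sup_left : U ≤ U ⊔ Submodule.span F {x}) (hU.2 _ hiso)
  rw [this]
  exact Submodule.mem_sup_right (Submodule.mem_span_singleton_self x)

theorem ncard_vectors_eq {V : Type*} [AddCommGroup V] [Module F V] {D : Set V} (h0 : 0 ∉ D)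
    (hD : ∀ c : F, c ≠ 0 → ∀ x ∈ D, c • x ∈ D) (U : Submodule F V) :
    {x ∈ D | x ∈ U}.ncard =
      {P : ℙ F V | P.rep ∈ D ∧ P.submodule ≤ U}.ncard * (Nat.card F - 1) := by
  rw [← Nat.card_units, ← Set.ncard_univ, ← Set.ncard_prod]
  have hle : ∀ P : ℙ F V, P.submodule ≤ U ↔ P.rep ∈ U := fun P => by
    rw [P.submodule_eq, Submodule.span_singleton_le_iff_mem]
  have hinj : Function.Injective fun q : ℙ F V × Fˣ => q.2 • q.1.rep := by
    rintro ⟨P, a⟩ ⟨Q, b⟩ h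
    simp only at h
    obtain rfl : P = Q := by
      rw [← P.mk_rep, ← Q.mk_rep, Projectivization.mk_eq_mk_iff]
      exact ⟨a⁻¹ * b, by rw [mul_smul, ← h, inv_smul_smul]⟩
    rw [Units.smul_def, Units.smul_def] at h
    rw [Prod.mk.injEq]
    exact ⟨rfl, Units.ext (smul_left_injective F P.rep_nonzero h)⟩
  rw [← Set.ncard_image_of_injective _ hinj]
  congr 1
  ext x
  constructor
  · rintro ⟨hx, hxU⟩
    have hx0 : x ≠ 0 := fun h => h0 (h ▸ hx)
    obtain ⟨a, ha⟩ := Projectivization.exists_smul_eq_mk_rep F x hx0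
    refine ⟨(Projectivization.mk F x hx0, a⁻¹), ⟨⟨?_, ?_⟩, Set.mem_univ _⟩, ?_⟩
    · rw [← ha]; exact hD a a.ne_zero x hx
    · rw [hle, ← ha]; exact U.smul_mem a.1 hxU
    · simp only [← ha, inv_smul_smul]
  · rintro ⟨⟨P, a⟩, ⟨⟨hP, hPU⟩, -⟩, rfl⟩
    exact ⟨hD a a.ne_zero _ hP, U.smul_mem a.1 ((hle P).1 hPU)⟩

end Symplectic

/-! ### Transfer of the ovoid to an arbitrary symplectic space. -/

theorem exists_isMOvoid {p e r l d b : ℕ} [Fact p.Prime] (hp : Odd p) (hl : 0 < l)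
    (he : e * r = 2 * l) (hd : Odd d) (hdN : d ∣ p ^ l + 1) (hdm : d * (p ^ e - 1) ∣ p ^ (e * r) - 1)
    (hb : b ≤ d) {F V : Type*} [Field F] [AddCommGroup V] [Module F V]
    {B : LinearMap.BilinForm F V} (hB : IsSymplecticForm p e r B) :
    ∃ M : Set (ℙ F V), IsMOvoid B (b * (p ^ (e * r) - 1) / (d * (p ^ e - 1))) M := by
  have hpp : p.Prime := Fact.out
  have he0 : e ≠ 0 := by rintro rfl; omega
  have hr0 : 0 < r := Nat.pos_of_ne_zero (by rintro rfl; omega)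
  have : Finite F := Nat.finite_of_card_ne_zero (by rw [hB.card_eq]; exact (pow_pos hpp.pos _).ne')
  have : FiniteDimensional F V :=
    Module.finite_of_finrank_pos (by rw [hB.finrank_eq]; omega)
  have : Finite V := Module.finite_of_finite F
  let _ := Fintype.ofFinite F
  have : CharP F p := charP_of_card_eq_prime_pow (by rw [← Nat.card_eq_fintype_card, hB.card_eq])
  have : NeZero (2 * r) := ⟨by omega⟩
  have hfinL := FiniteField.finrank_extension F p (2 * r)
  obtain ⟨B', hB', hsets⟩ := exists_form_and_sets (L := FiniteField.Extension F p (2 * r)) hp hl he hd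
    hdN hdm hB.card_eq hfinL
  obtain ⟨f, hf⟩ := exists_symplectic_isometry hB.isAlt hB.nondegenerate hB'.isAlt hB'.nondegenerate
    (by rw [hB.finrank_eq, hfinL])
  obtain ⟨D, h0, hD, hcount⟩ := hsets b hb
  refine ⟨{P | f P.rep ∈ D}, fun U hU => ?_⟩
  have hUo := hU.orthogonal_eq hB.isAlt
  have hfU : B'.orthogonal (U.map (f : V →ₗ[F] _)) = U.map (f : V →ₗ[F] _) := by
    ext x
    obtain ⟨x, rfl⟩ := f.surjective x
    rw [LinearMap.BilinForm.mem_orthogonal_iff]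
    have h1 : f x ∈ U.map (f : V →ₗ[F] _) ↔ x ∈ U := by
      rw [Submodule.mem_map]
      exact ⟨fun ⟨y, hy, h⟩ => f.injective h ▸ hy, fun h => ⟨x, h, rfl⟩⟩
    rw [h1]
    nth_rewrite 2 [← hUo]
    rw [LinearMap.BilinForm.mem_orthogonal_iff]
    constructor
    · intro h u hu
      have := h (f u) ⟨u, hu, rfl⟩
      rwa [hf] at this
    · rintro h _ ⟨u, hu, rfl⟩
      exact (hf u x).trans (h u hu)
  have hc := hcount _ hfU
  have hpre : {x ∈ D | x ∈ U.map (f : V →ₗ[F] _)}.ncard = {x ∈ f ⁻¹' D | x ∈ U}.ncard := by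
    rw [← Set.ncard_image_of_injective _ f.injective]
    congr 1
    ext x
    constructor
    · rintro ⟨hx, y, hy, rfl⟩; exact ⟨y, ⟨hx, hy⟩, rfl⟩
    · rintro ⟨y, ⟨hx, hy⟩, rfl⟩; exact ⟨hx, y, hy, rfl⟩
  rw [hpre, ncard_vectors_eq (F := F) (by simpa using h0)
    (fun c hc x hx => by rw [Set.mem_preimage, map_smul]; exact hD c hc _ hx), hB.card_eq] at hc
  have hpos : 0 < d * (p ^ e - 1) :=
    Nat.mul_pos hd.pos (Nat.sub_pos_of_lt (Nat.one_lt_pow he0 hpp.one_lt))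
  rw [← hc, mul_assoc, mul_comm (p ^ e - 1), Nat.mul_div_cancel _ hpos, Set.Finite.cast_ncard_eq (Set.toFinite _)]
  rfl

/-! ### Arithmetic of `d₀` and growth of `m`. -/

section Arithmetic

theorem pow_add_one_dvd {p r : ℕ} (hr : Odd r) (k : ℕ) : p ^ k + 1 ∣ p ^ (r * k) + 1 := by
  have := hr.nat_add_dvd_pow_add_pow (p ^ k) 1
  rwa [one_pow, ← pow_mul, mul_comm k] at this

theorem pow_lt_quotient {p r k : ℕ} (hp1 : 1 < p) (hr5 : 5 ≤ r) (hk : 1 ≤ k) :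
    p ^ k < (p ^ (r * k) + 1) / (p ^ k + 1) := by
  have hQ : 1 < p ^ k := Nat.one_lt_pow (by omega) hp1
  have h5 : (p ^ k) ^ 5 ≤ p ^ (r * k) := by
    rw [mul_comm r, pow_mul]; exact Nat.pow_le_pow_right hQ.le hr5
  rw [← Nat.add_one_le_iff, Nat.le_div_iff_mul_le (by omega)]
  generalize p ^ k = Q at *
  have h2 : 2 * 2 ≤ Q * Q := Nat.mul_le_mul hQ hQ
  have : Q ^ 5 = (Q * Q) * (Q * Q * Q) := by ring
  nlinarith [Nat.mul_le_mul h2 (le_refl (Q * Q * Q)), Nat.mul_le_mul hQ.le (le_refl (Q * Q)),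
    Nat.mul_le_mul hQ.le (le_refl Q)]

theorem sub_one_dvd_pow_mul_sub_one (p k r : ℕ) :
    p ^ (2 * k) - 1 ∣ p ^ (2 * k * r) - 1 := by
  rw [pow_mul p (2 * k) r]
  simpa using Nat.sub_dvd_pow_sub_pow (p ^ (2 * k)) 1 r

/-- Let `c` be the quotient. The even factor `p ^ k + 1` absorbs the halving in the first gcd entry;
factoring both differences of squares shows the second entry to be `c (p ^ (r k) - 1) / (p ^ k -
1)`. -/
theorem quotient_dvd_dZero {p r k : ℕ} (hp : Odd p) (hp1 : 1 < p) (hr : Odd r) (hk : 1 ≤ k) :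
    (p ^ (r * k) + 1) / (p ^ k + 1) ∣ dZero p (2 * k) r (r * k) := by
  obtain ⟨c, hc⟩ := pow_add_one_dvd (p := p) hr k
  have hQ : 1 < p ^ k := Nat.one_lt_pow (by omega) hp1
  rw [hc, Nat.mul_div_cancel_left _ (by omega)]
  refine Nat.dvd_gcd ?_ ?_
  · obtain ⟨j, hj⟩ : 2 ∣ p ^ k + 1 := (hp.pow.add_one).two_dvd
    rw [hc, hj, mul_assoc, Nat.mul_div_cancel_left _ two_pos]
    exact dvd_mul_left _ _
  · obtain ⟨g, hg⟩ : p ^ k - 1 ∣ p ^ (r * k) - 1 := by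
      rw [mul_comm r, pow_mul]
      simpa using Nat.sub_dvd_pow_sub_pow (p ^ k) 1 r
    have h1 : ∀ x : ℕ, x ^ 2 - 1 = (x + 1) * (x - 1) := fun x => by
      simpa using Nat.sq_sub_sq x 1
    have e1 : p ^ (2 * k * r) - 1 = (p ^ (2 * k) - 1) * (g * c) := by
      rw [show 2 * k * r = r * k * 2 by ring, pow_mul p (r * k), h1, hc, hg, mul_comm 2 k, pow_mul p k,
        h1]
      ring
    have e2 : 0 < p ^ (2 * k) - 1 := Nat.sub_pos_of_lt (Nat.one_lt_pow (by omega) hp1)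
    rw [e1, Nat.mul_div_cancel_left _ e2]
    exact dvd_mul_left _ _

/-- The second gcd entry is a geometric sum of `r` odd terms, with `r` odd. -/
theorem odd_dZero {p r k : ℕ} (hp : Odd p) (hp1 : 1 < p) (hr : Odd r) (hk : 1 ≤ k) :
    Odd (dZero p (2 * k) r (r * k)) := by
  refine Odd.of_dvd_nat ?_ (Nat.gcd_dvd_right _ _)
  rw [pow_mul p (2 * k) r, ← Nat.geomSum_eq (Nat.one_lt_pow (by omega) hp1),
    Finset.odd_sum_iff_odd_card_odd, Finset.filter_true_of_mem fun i _ => hp.pow.pow]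
  simpa using hr

theorem dZero_dvd {p r k : ℕ} (hp : Odd p) : dZero p (2 * k) r (r * k) ∣ p ^ (r * k) + 1 :=
  (Nat.gcd_dvd_left _ _).trans (Nat.div_dvd_of_dvd (hp.pow.add_one).two_dvd)

theorem dZero_mul_dvd (p r k : ℕ) :
    dZero p (2 * k) r (r * k) * (p ^ (2 * k) - 1) ∣ p ^ (2 * k * r) - 1 := by
  obtain ⟨g, hg⟩ := sub_one_dvd_pow_mul_sub_one p k r
  rcases Nat.eq_zero_or_pos (p ^ (2 * k) - 1) with h0 | h0
  · rw [hg, h0]; simp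
  · rw [dZero, Nat.div_eq_of_eq_mul_right h0 hg, hg, mul_comm]
    exact mul_dvd_mul_left _ (Nat.gcd_dvd_right _ _)

theorem pow_lt_dZero {p r k : ℕ} (hp : Odd p) (hp1 : 1 < p) (hr : Odd r) (hr5 : 5 ≤ r) (hk : 1 ≤ k) :
    p ^ k < dZero p (2 * k) r (r * k) :=
  (pow_lt_quotient hp1 hr5 hk).trans_le
    (Nat.le_of_dvd (odd_dZero hp hp1 hr hk).pos (quotient_dvd_dZero hp hp1 hr hk))

theorem one_le_ovoidParam {p r k b : ℕ} (hp : Odd p) (hp1 : 1 < p) (hr : Odd r) (hr5 : 5 ≤ r)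
    (hk : 1 ≤ k) (hb : 1 ≤ b) : 1 ≤ ovoidParam p (2 * k) r (r * k) b := by
  have h1 : 0 < p ^ (2 * k) - 1 := Nat.sub_pos_of_lt (Nat.one_lt_pow (by omega) hp1)
  have h2 : 0 < p ^ (2 * k * r) - 1 :=
    Nat.sub_pos_of_lt (Nat.one_lt_pow (Nat.mul_pos (by omega) (by omega)).ne' hp1)
  exact Nat.div_pos (Nat.le_of_dvd (Nat.mul_pos hb h2) ((dZero_mul_dvd p r k).mul_left b))
    (Nat.mul_pos (odd_dZero hp hp1 hr hk).pos h1)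

/-- Bound `d₀` below by `(p ^ (r k) + 1) / (p ^ k + 1)` and cancel the `+ 1` factors of the
differences of squares. -/
theorem ovoidParam_le {p r k : ℕ} (hp : Odd p) (hp1 : 1 < p) (hr : Odd r) (hk : 1 ≤ k) (b : ℕ) :
    (ovoidParam p (2 * k) r (r * k) b : ℝ) ≤ b * ((p : ℝ) ^ (r * k) - 1) / ((p : ℝ) ^ k - 1) := by
  have hQ : 1 < p ^ k := Nat.one_lt_pow (by omega) hp1
  have hdpos := (odd_dZero hp hp1 hr hk).pos
  have hle : p ^ (r * k) + 1 ≤ dZero p (2 * k) r (r * k) * (p ^ k + 1) := by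
    obtain ⟨c, hc⟩ := pow_add_one_dvd (p := p) hr k
    have h := Nat.le_of_dvd hdpos (quotient_dvd_dZero hp hp1 hr hk)
    rw [hc, Nat.mul_div_cancel_left _ (by omega)] at h
    rw [hc, mul_comm]
    exact Nat.mul_le_mul_right _ h
  have hm := Nat.div_mul_cancel ((dZero_mul_dvd p r k).mul_left b)
  change ovoidParam p (2 * k) r (r * k) b * _ = _ at hm
  generalize ovoidParam p (2 * k) r (r * k) b = m at *
  generalize dZero p (2 * k) r (r * k) = d at *
  rw [show 2 * k * r = r * k * 2 by ring, mul_comm 2 k, pow_mul p (r * k), pow_mul p k] at hm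
  have hP : 1 ≤ p ^ (r * k) := Nat.one_le_pow _ _ (by omega)
  have hm' : (m : ℝ) * (d * (((p : ℝ) ^ k) ^ 2 - 1)) = b * (((p : ℝ) ^ (r * k)) ^ 2 - 1) := by
    have := congrArg (Nat.cast (R := ℝ)) hm
    rw [Nat.cast_mul, Nat.cast_mul, Nat.cast_mul, Nat.cast_sub (Nat.one_le_pow _ _ (by omega)),
      Nat.cast_sub (Nat.one_le_pow _ _ (by omega))] at this
    simpa using this
  have hle' : (p : ℝ) ^ (r * k) + 1 ≤ d * ((p : ℝ) ^ k + 1) := by exact_mod_cast hle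
  have hQ' : (1 : ℝ) < (p : ℝ) ^ k := by exact_mod_cast hQ
  have hP' : (1 : ℝ) ≤ (p : ℝ) ^ (r * k) := by exact_mod_cast hP
  generalize (p : ℝ) ^ k = Q at *
  generalize (p : ℝ) ^ (r * k) = R at *
  have hd' : (0 : ℝ) < d := by exact_mod_cast hdpos
  rw [le_div_iff₀ (by linarith)]
  have h3 : (m * (Q - 1)) * (d * (Q + 1)) ≤ (b * (R - 1)) * (d * (Q + 1)) := by
    calc (m * (Q - 1)) * (d * (Q + 1)) = b * (R - 1) * (R + 1) := by linear_combination hm'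
      _ ≤ _ := mul_le_mul_of_nonneg_left hle' (mul_nonneg (Nat.cast_nonneg b) (by linarith))
  exact le_of_mul_le_mul_right h3 (mul_pos hd' (by linarith))

theorem ovoidParam_div_le {p r k : ℕ} (hp : Odd p) (hp1 : 1 < p) (hr : Odd r) (hk : 1 ≤ k) (b : ℕ) :
    (ovoidParam p (2 * k) r (r * k) b : ℝ) / (p : ℝ) ^ (2 * k * (r - 2)) ≤
      b * ((p : ℝ) ^ (r * k) - 1) / (((p : ℝ) ^ k - 1) * (p : ℝ) ^ (2 * k * (r - 2))) := by
  rw [← div_div]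
  exact div_le_div_of_nonneg_right (ovoidParam_le hp hp1 hr hk b) (by positivity)

theorem ovoidParam_div_le_inv_pow {p r k : ℕ} (hp : Odd p) (hp1 : 1 < p) (hr : Odd r) (hr5 : 5 ≤ r)
    (hk : 1 ≤ k) (b : ℕ) :
    (ovoidParam p (2 * k) r (r * k) b : ℝ) / (p : ℝ) ^ (2 * k * (r - 2)) ≤
      2 * b * ((p : ℝ)⁻¹) ^ k := by
  refine (ovoidParam_div_le hp hp1 hr hk b).trans ?_
  have hQ : (2 : ℝ) ≤ (p : ℝ) ^ k := by exact_mod_cast Nat.one_lt_pow (by omega) hp1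
  have hp0 : (1 : ℝ) ≤ p := by exact_mod_cast hp1.le
  -- This is `r ≤ 2 (r - 2)`, where `r ≥ 4` is needed; the factor `2` in the bound comes from `Q ≤ 2
  -- (Q - 1)`.
  have hle : (p : ℝ) ^ (r * k) ≤ (p : ℝ) ^ (2 * k * (r - 2)) := by
    refine pow_le_pow_right₀ hp0 ?_
    rw [mul_comm 2 k, mul_assoc, mul_comm r k]
    exact Nat.mul_le_mul_left _ (by omega)
  have hpos : (0 : ℝ) < (p : ℝ) ^ (2 * k * (r - 2)) := by positivity
  rw [inv_pow, ← div_eq_mul_inv, div_le_div_iff₀ (mul_pos (by linarith) hpos) (by linarith)]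
  generalize (p : ℝ) ^ k = Q at *
  generalize (p : ℝ) ^ (r * k) = R at *
  generalize (p : ℝ) ^ (2 * k * (r - 2)) = S at *
  have hb : (0 : ℝ) ≤ b := Nat.cast_nonneg b
  calc b * (R - 1) * Q ≤ b * S * Q := by gcongr; linarith
    _ ≤ b * S * (2 * (Q - 1)) := by gcongr; linarith
    _ = _ := by ring

theorem tendsto_ovoidParam_div {p r : ℕ} (hp : Odd p) (hp1 : 1 < p) (hr : Odd r) (hr5 : 5 ≤ r)
    (b : ℕ) :
    Tendsto (fun k : ℕ => (ovoidParam p (2 * k) r (r * k) b : ℝ) / (p : ℝ) ^ (2 * k * (r - 2)))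
      atTop (𝓝 0) := by
  have hlim : Tendsto (fun k : ℕ => 2 * (b : ℝ) * ((p : ℝ)⁻¹) ^ k) atTop (𝓝 0) := by
    simpa using (tendsto_pow_atTop_nhds_zero_of_lt_one (r := (p : ℝ)⁻¹) (by positivity)
      (inv_lt_one_of_one_lt₀ (by exact_mod_cast hp1))).const_mul (2 * (b : ℝ))
  refine squeeze_zero' (Eventually.of_forall fun k => by positivity) ?_ hlim
  filter_upwards [eventually_ge_atTop 1] with k hk
  exact ovoidParam_div_le_inv_pow hp hp1 hr hr5 hk b

end Arithmetic

/-! ### Existence of the ovoids and failure of every lower bound. -/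

/-- For odd `p` and odd `r ≥ 5` the ovoids of all admissible sizes exist. -/
theorem exists_isMOvoid_ovoidParam {p r k b : ℕ} (hpp : p.Prime) (hp : Odd p) (hr : Odd r)
    (hk : 1 ≤ k) (hb : b ≤ dZero p (2 * k) r (r * k)) {F V : Type*} [Field F]
    [AddCommGroup V] [Module F V] {B : LinearMap.BilinForm F V} (hB : IsSymplecticForm p (2 * k) r B) :
    ∃ M : Set (ℙ F V), IsMOvoid B (ovoidParam p (2 * k) r (r * k) b) M := by
  have : Fact p.Prime := ⟨hpp⟩
  exact exists_isMOvoid (l := r * k) hp (Nat.mul_pos hr.pos hk) (by ring)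
    (odd_dZero hp hpp.one_lt hr hk) (dZero_dvd hp) (dZero_mul_dvd p r k) hb hB

theorem exists_isSymplecticForm {p k r : ℕ} (hpp : p.Prime) (hp : Odd p) (hk : 1 ≤ k) (hr : 0 < r) :
    ∃ (F V : Type) (_ : Field F) (_ : AddCommGroup V) (_ : Module F V) (B : LinearMap.BilinForm F V),
      IsSymplecticForm p (2 * k) r B := by
  have : Fact p.Prime := ⟨hpp⟩
  have : NeZero (2 * r) := ⟨by omega⟩
  have : Finite (GaloisField p (2 * k)) := Nat.finite_of_card_ne_zero <| by
    rw [GaloisField.card p (2 * k) (by omega)]; exact (pow_pos hpp.pos _).ne'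
  -- Only the form is wanted here, so the trivial class number `d = 1` suffices.
  obtain ⟨B, hB, -⟩ := exists_form_and_sets (p := p) (e := 2 * k) (r := r) (l := r * k) (d := 1) hp
    (Nat.mul_pos hr hk) (by ring) odd_one (one_dvd _)
    (by rw [one_mul]; exact sub_one_dvd_pow_mul_sub_one p k r)
    (GaloisField.card p (2 * k) (by omega))
    (FiniteField.finrank_extension (GaloisField p (2 * k)) p (2 * r))
  exact ⟨_, _, _, _, _, B, hB⟩

theorem not_ovoidLowerBound {p r : ℕ} (hpp : p.Prime) (hp : Odd p) (hr : Odd r) (hr5 : 5 ≤ r) {c : ℝ}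
    (hc : 0 < c) : ¬ OvoidLowerBound p r c := by
  intro h
  have hp1 := hpp.one_lt
  -- A single class, `b = 1`, already violates the bound for large `k`.
  obtain ⟨k, hk, hlt⟩ := ((eventually_ge_atTop 1).and
    ((tendsto_ovoidParam_div hp hp1 hr hr5 1).eventually_lt_const hc)).exists
  obtain ⟨F, V, _, _, _, B, hB⟩ := exists_isSymplecticForm (k := k) hpp hp hk hr.pos
  have hM := exists_isMOvoid_ovoidParam hpp hp hr hk (odd_dZero hp hp1 hr hk).pos hB
  have hle := h (2 * k) _ (by omega) (one_le_ovoidParam hp hp1 hr hr5 hk le_rfl) F V B hB hM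
  have hp0 : (0 : ℝ) < p := by exact_mod_cast hpp.pos
  rw [div_lt_iff₀ (by positivity)] at hlt
  linarith

theorem mainTheorem3 :
    (∀ p r : ℕ, ((p, r) = (3, 5) ∨ (p, r) = (5, 7) ∨ (p, r) = (5, 11)) →
      -- the divisibility of `d₀`, with `e = 2ℓ₀` and `ℓ = rℓ₀` (case (B), `t = 2`)
      (∀ ℓ₀ : ℕ, 1 ≤ ℓ₀ →
        (p ^ ℓ₀ + 1) ∣ (p ^ (r * ℓ₀) + 1) ∧
        (p ^ (r * ℓ₀) + 1) / (p ^ ℓ₀ + 1) ∣ dZero p (2 * ℓ₀) r (r * ℓ₀) ∧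
        1 < dZero p (2 * ℓ₀) r (r * ℓ₀)) ∧
      -- the `m`-ovoids exist, and `m` is a positive integer satisfying the upper bound
      (∀ ℓ₀ b : ℕ, 1 ≤ ℓ₀ → 1 ≤ b → b ≤ dZero p (2 * ℓ₀) r (r * ℓ₀) - 1 →
        dZero p (2 * ℓ₀) r (r * ℓ₀) * (p ^ (2 * ℓ₀) - 1) ∣ b * (p ^ (2 * ℓ₀ * r) - 1) ∧
        1 ≤ ovoidParam p (2 * ℓ₀) r (r * ℓ₀) b ∧
        (∀ (F : Type u) (V : Type v) [Field F] [AddCommGroup V] [Module F V]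
          (B : LinearMap.BilinForm F V), IsSymplecticForm p (2 * ℓ₀) r B →
            ∃ M : Set (ℙ F V), IsMOvoid B (ovoidParam p (2 * ℓ₀) r (r * ℓ₀) b) M) ∧
        (ovoidParam p (2 * ℓ₀) r (r * ℓ₀) b : ℝ) / (p : ℝ) ^ (2 * ℓ₀ * (r - 2)) ≤
          b * ((p : ℝ) ^ (r * ℓ₀) - 1) /
            (((p : ℝ) ^ ℓ₀ - 1) * (p : ℝ) ^ (2 * ℓ₀ * (r - 2)))) ∧
      -- every fixed `b ≥ 1` is admissible for all large `ℓ₀`, and then `m / p ^ (e (r - 2)) → 0`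
      (∀ b : ℕ, 1 ≤ b →
        (∀ᶠ ℓ₀ : ℕ in atTop, b ≤ dZero p (2 * ℓ₀) r (r * ℓ₀) - 1) ∧
        Tendsto (fun ℓ₀ : ℕ =>
          (ovoidParam p (2 * ℓ₀) r (r * ℓ₀) b : ℝ) / (p : ℝ) ^ (2 * ℓ₀ * (r - 2)))
          atTop (𝓝 0)) ∧
      -- no positive constant works, even for this fixed pair `p`, `r`
      (¬ ∃ c : ℝ, 0 < c ∧ OvoidLowerBound p r c)) ∧
    ¬ BambergConjecture := by
  have hpr : ∀ p r : ℕ, ((p, r) = (3, 5) ∨ (p, r) = (5, 7) ∨ (p, r) = (5, 11)) →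
      p.Prime ∧ Odd p ∧ Odd r ∧ 5 ≤ r := by
    rintro p r (h | h | h) <;> obtain ⟨rfl, rfl⟩ := Prod.mk.inj h <;> decide
  refine ⟨fun p r h => ?_, ?_⟩
  · obtain ⟨hpp, hp, hr, hr5⟩ := hpr p r h
    have hp1 := hpp.one_lt
    refine ⟨fun k hk => ⟨pow_add_one_dvd hr k, quotient_dvd_dZero hp hp1 hr hk, ?_⟩,
      fun k b hk hb hbd => ⟨(dZero_mul_dvd p r k).mul_left b,
        one_le_ovoidParam hp hp1 hr hr5 hk hb, ?_, ovoidParam_div_le hp hp1 hr hk b⟩,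
      fun b hb => ⟨?_, tendsto_ovoidParam_div hp hp1 hr hr5 b⟩, ?_⟩
    · exact (Nat.one_le_pow _ _ hpp.pos).trans_lt (pow_lt_dZero hp hp1 hr hr5 hk)
    · intro F V _ _ _ B hB
      exact exists_isMOvoid_ovoidParam hpp hp hr hk (by omega) hB
    · filter_upwards [eventually_ge_atTop (b + 1)] with k hk
      have h1 := pow_lt_dZero hp hp1 hr hr5 (k := k) (by omega)
      have h2 := Nat.lt_pow_self hp1 (n := k)
      omega
    · rintro ⟨c, hc, hbound⟩
      exact not_ovoidLowerBound hpp hp hr hr5 hc hbound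
  · rintro ⟨c, hc, hbound⟩
    exact not_ovoidLowerBound (p := 3) (r := 5) (by decide) (by decide) (by decide) le_rfl hc
      (hbound 3 5 (by decide) (by decide))
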